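/- Let $q\in\mathbb R$, $t>0$, and let $\{\mu(i,j)\}_{1\le i<j}$ be independent, identically distributed, (almost surely) non-vanishing real random variables on a probability space, with $\mathbb E(\mu(i,j))=q/t$ and $\mathbb E(\mu(i,j)^2)=1$. For each realization put $\mu_{*,*}(i,j)=\mu(i,j)$ for $i<j$, and define the remaining coefficients $\mu_{\epsilon,\epsilon'}(i,j)$ ($\epsilon,\epsilon'\in\{1,*\}$, $i\neq j$) by requiring, for $i<j$, $$\mu_{1,1}(i,j)=\frac1{\mu_{*,*}(i,j)},\quad \mu_{*,1}(i,j)=t\,\mu_{*,*}(i,j),\quad \mu_{1,*}(i,j)=\frac1{\mu_{*,1}(i,j)},\quad \mu_{\epsilon',\epsilon}(j,i)=\frac1{\mu_{\epsilon,\epsilon'}(i,j)}.$$ Then for almost every realization of $\{\mu(i,j)\}_{i<j}$ the following holds. Let $\mathscr A$ be any unital complex $*$-algebra, $\varphi:\mathscr A\to\mathbb C$ a state (a unital positive linear functional), and $b_1,b_2,\ldots\in\mathscr A$ a sequence such that 1. $\varphi(b_i)=\varphi(b_i^*)=\varphi(b_ib_i)=\varphi(b_i^*b_i^*)=\varphi(b_i^*b_i)=0$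 for all $i$; 2. $\varphi(b_i^{\epsilon}b_i^{\epsilon'})=\varphi(b_j^{\epsilon}b_j^{\epsilon'})$ for all $i,j$ and $\epsilon,\epsilon'\in\{1,*\}$ (this common value is written $\varphi(b^{\epsilon}b^{\epsilon'})$); 3. for every $n$ there is a constant $\alpha_n$ with $|\varphi(b_{j(1)}^{\epsilon(1)}\cdots b_{j(n)}^{\epsilon(n)})|\le\alpha_n$ for all $j(1),\ldots,j(n)\in\mathbb N$ and $\epsilon(1),\ldots,\epsilon(n)\in\{1,*\}$; 4. $\varphi$ factors over naturally ordered products: whenever $i_1<\cdots<i_m$ and each $B_k$ is a product $b_{i_k}^{\epsilon_{k,1}}\cdots b_{i_k}^{\epsilon_{k,r_k}}$ with $r_k\ge1$ and $\epsilon_{k,l}\in\{1,*\}$, one has $\varphi(B_1\cdots B_m)=\varphi(B_1)\cdots\varphi(B_m)$; 5. $b_i^{\epsilon}b_j^{\epsilon'}=\mu_{\epsilon',\epsilon}(j,i)\,b_j^{\epsilon'}b_i^{\epsilon}$ for all $i\ne j$ and $\epsilon,\epsilon'\in\{1,*\}$, with the coefficients of the given realization. Put $S_N=(b_1+\cdots+b_N)/\sqrt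 N$. Then every odd $*$-moment of $S_N$ tends to zero: for all $n\ge1$ and $\epsilon(1),\ldots,\epsilon(2n-1)\in\{1,*\}$, $$\lim_{N\to\infty}\varphi(S_N^{\epsilon(1)}\cdots S_N^{\epsilon(2n-1)})=0,$$ and for all $n\ge0$ and $\epsilon(1),\ldots,\epsilon(2n)\in\{1,*\}$, $$\lim_{N\to\infty}\varphi(S_N^{\epsilon(1)}\cdots S_N^{\epsilon(2n)})=\sum_{\mathscr V\in\mathscr P_2(2n)}q^{\mathrm{cr}(\mathscr V)}\,t^{\mathrm{ne}(\mathscr V)}\prod_{i=1}^n\varphi(b^{\epsilon(w_i)}b^{\epsilon(z_i)}).$$ Here $\mathscr P_2(2n)$ is the set of pair partitions $\mathscr V=\{(w_1,z_1),\ldots,(w_n,z_n)\}$ of $\{1,\ldots,2n\}$, written with $w_i<z_i$ and $w_1<\cdots<w_n$; $\mathrm{cr}(\mathscr V)$ is the number of pairs $(i,j)$ with $w_i<w_j<z_i<z_j$ and $\mathrm{ne}(\mathscr V)$ the number of pairs $(i,j)$ with $w_i<w_j<z_j<z_i$. -/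

import Mathlib

open MeasureTheory ProbabilityTheory Filter Topology
open scoped ComplexOrder

universe u v

namespace NCCLT

/-- The exponents `1` and `∗`. -/
inductive Expo where
  | one : Expo
  | adj : Expo

/-- The power `a ^ ε`, i.e. `a` if `ε = 1` and `a∗` if `ε = ∗`. -/
def epow {A : Type*} [Star A] (a : A) : Expo → A
  | Expo.one => a
  | Expo.adj => star a

/-- A state on a unital complex `∗`-algebra: a unital positive linear functional. -/
structure IsState {A : Type*} [Ring A] [StarRing A] [Algebra ℂ A] (φ : A →ₗ[ℂ] ℂ) : Prop where
  map_one : φ 1 = 1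
  nonneg : ∀ a : A, 0 ≤ φ (a * star a)

/-- `φ` factors over the naturally ordered products in `b`. A naturally ordered product is a
concatenation of nonempty blocks, the block `(i, [ε₁, …, ε_k])` being `b_i^ε₁ ⋯ b_i^ε_k`, with
strictly increasing indices `i` from each block to the next. -/
def FactorsOverNaturallyOrdered {A : Type*} [Ring A] [StarRing A] [Algebra ℂ A]
    (φ : A →ₗ[ℂ] ℂ) (b : ℕ → A) : Prop :=
  ∀ L : List (ℕ × List Expo),
    (∀ B ∈ L, B.2 ≠ []) →
    (L.map Prod.fst).Pairwise (· < ·) →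
    φ ((L.map fun B => (B.2.map (epow (b B.1))).prod).prod) =
      (L.map fun B => φ ((B.2.map (epow (b B.1))).prod)).prod

/-- The moment conditions on the sequence `b` (indexed from `0`) in `(A, φ)`. -/
structure MomentCondition {A : Type*} [Ring A] [StarRing A] [Algebra ℂ A]
    (φ : A →ₗ[ℂ] ℂ) (b : ℕ → A) : Prop where
  centred : ∀ i, φ (b i) = 0
  centred_star : ∀ i, φ (star (b i)) = 0
  mul_self : ∀ i, φ (b i * b i) = 0
  star_mul_star : ∀ i, φ (star (b i) * star (b i)) = 0
  star_mul_self : ∀ i, φ (star (b i) * b i) = 0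
  cov_eq : ∀ (i j : ℕ) (e e' : Expo),
    φ (epow (b i) e * epow (b i) e') = φ (epow (b j) e * epow (b j) e')
  bounded : ∀ n : ℕ, ∃ α : ℝ, ∀ (j : Fin n → ℕ) (ε : Fin n → Expo),
    ‖φ (List.ofFn fun k => epow (b (j k)) (ε k)).prod‖ ≤ α
  factors : FactorsOverNaturallyOrdered φ b

/-- `b_i^ε b_j^ε' = c_{ε',ε}(j,i) b_j^ε' b_i^ε` for all `i ≠ j`, where `c ε ε' i j` stands for
the coefficient `c_{ε,ε'}(i,j)`. -/
def CommutationRelation {A : Type*} [Ring A] [StarRing A] [Algebra ℂ A]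
    (c : Expo → Expo → ℕ → ℕ → ℝ) (b : ℕ → A) : Prop :=
  ∀ i j : ℕ, i ≠ j → ∀ e e' : Expo,
    epow (b i) e * epow (b j) e' = ((c e' e j i : ℝ) : ℂ) • (epow (b j) e' * epow (b i) e)

/-- The coefficients `μ_{ε,ε'}(i,j)` for `i < j` in terms of `m = μ_{∗,∗}(i,j)`. -/
noncomputable def upperCoeff (t m : ℝ) : Expo → Expo → ℝ
  | Expo.adj, Expo.adj => m
  | Expo.one, Expo.one => 1 / m
  | Expo.adj, Expo.one => t * m
  | Expo.one, Expo.adj => 1 / (t * m)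

/-- All the coefficients `μ_{ε,ε'}(i,j)`, `i ≠ j`, obtained from the numbers `μ(i,j)`, `i < j`,
using `μ_{ε',ε}(j,i) = 1 / μ_{ε,ε'}(i,j)`. The values at `i = j` play no role. -/
noncomputable def commCoeff (t : ℝ) (μ : ℕ → ℕ → ℝ) (e e' : Expo) (i j : ℕ) : ℝ :=
  if i < j then upperCoeff t (μ i j) e e' else 1 / upperCoeff t (μ j i) e' e

/-- `S_N = (b_1 + ⋯ + b_N) / √N`; the sequence is indexed from `0` here. -/
noncomputable def partialSum {A : Type*} [Ring A] [Algebra ℂ A] (b : ℕ → A) (N : ℕ) : A :=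
  ((1 / Real.sqrt N : ℝ) : ℂ) • ∑ i ∈ Finset.range N, b i

/-- The mixed `∗`-moment `φ(a^ε(1) ⋯ a^ε(r))`. -/
noncomputable def starMoment {A : Type*} [Ring A] [StarRing A] [Algebra ℂ A]
    (φ : A →ₗ[ℂ] ℂ) (a : A) {r : ℕ} (ε : Fin r → Expo) : ℂ :=
  φ (List.ofFn fun k => epow a (ε k)).prod

/-- The pair partitions of an `m`-element ordered set, each given as the set of its blocks
`(w, z)` with `w < z`: every element lies in exactly one block. -/
def pairPartitions (m : ℕ) : Finset (Finset (Fin m × Fin m)) :=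
  Finset.univ.filter fun V =>
    (∀ p ∈ V, p.1 < p.2) ∧ ∀ k : Fin m, (V.filter fun p => p.1 = k ∨ p.2 = k).card = 1

/-- The number of crossings `w < w' < z < z'` with `(w, z), (w', z') ∈ V`. -/
def crossings {m : ℕ} (V : Finset (Fin m × Fin m)) : ℕ :=
  ((V ×ˢ V).filter fun x => x.1.1 < x.2.1 ∧ x.2.1 < x.1.2 ∧ x.1.2 < x.2.2).card

/-- The number of nestings `w < w' < z' < z` with `(w, z), (w', z') ∈ V`. -/
def nestings {m : ℕ} (V : Finset (Fin m × Fin m)) : ℕ :=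
  ((V ×ˢ V).filter fun x => x.1.1 < x.2.1 ∧ x.2.1 < x.2.2 ∧ x.2.2 < x.1.2).card

end NCCLT

/-! Expand the moment of `S_N` over index tuples `j`. The commutation relations put each word in
natural order at the cost of a scalar, a product over the inversions of `j` (`word_eq_smul`), and
`φ` then factors over the indices (`map_word`). A word with an index occurring only once vanishes.
Of the remaining words, those that are not pairings use fewer than `m / 2` distinct indices, so
uniform boundedness and the normalization make them negligible (`tendsto_sum_not_isPairing`). What
survives is a sum over pair partitions `V` and injective labellings of the blocks of `V`.

Only `φ(b b*)` can be nonzero, so only words in which every block opens with `1` and closes with `*`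
matter. The inversion product for such a word splits over pairs of blocks (`wordWeight_pairing`).
With `μ` the coefficient attached to the two labels, disjoint blocks give `1`, a crossing gives
`tμ`, and a nesting gives `tμ²` or `t` according to the order of the labels. Since `E μ = q/t` and
`E μ² = 1`, these factors have means `1`, `q` and `t` in every order.

Distinct pairs of blocks read distinct entries of the array, so it remains to prove a strong law for
averages, over injective labellings, of products of entries along the edges of a graph
(`ae_tendsto_edge_product_average`). A nesting factor is only known to have a first moment, so a
variance estimate does not apply directly. The kernel is truncated. The bounded part obeys a strong
law by summable variances, because two tuples are correlated only when they share two vertices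
(`ae_tendsto_of_dissociated`). The tail is controlled uniformly in `N` by a maximal inequality for
jointly exchangeable arrays (`exchangeable_maximal_inequality`). There are countably many pair
partitions, so a single null set serves all algebras, states and sequences. -/

open scoped ENNReal

namespace NCCLT

/-! ### Maximal inequality for jointly exchangeable arrays. -/

section Exchangeable

variable {ι E : Type*} [Fintype ι]

/-- A permutation of `ℕ` that moves only numbers below `N` and carries one given tuple of distinct
numbers below `N` to another. -/
theorem exists_perm_extending {N : ℕ} (e : ι → ℕ) (he : Function.Injective e)
    (heN : ∀ a, e a < N) (i : ι ↪ Fin N) :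
    ∃ π : Equiv.Perm ℕ, (∀ a, π (e a) = i a) ∧ ∀ k, N ≤ k → π k = k := by
  classical
  let e' : ι → Fin N := fun a => ⟨e a, heN a⟩
  have he' : Function.Injective e' := fun a b h => he (by simpa [e'] using h)
  let ρ : {x // x ∈ Set.range e'} ≃ {x // x ∈ Set.range i} :=
    (Equiv.ofInjective e' he').symm.trans (Equiv.ofInjective i i.injective)
  let σ : Equiv.Perm (Fin N) := ρ.extendSubtype
  have hσ : ∀ a, σ (e' a) = i a := by
    intro a
    have h1 : σ (e' a) = ρ ⟨e' a, a, rfl⟩ := ρ.extendSubtype_apply_of_mem _ ⟨a, rfl⟩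
    have h2 : (Equiv.ofInjective e' he').symm ⟨e' a, a, rfl⟩ = a :=
      Equiv.ofInjective_symm_apply he' a
    rw [h1]
    simp only [ρ, Equiv.trans_apply, h2, Equiv.ofInjective_apply]
  refine ⟨σ.extendDomain (Fin.equivSubtype (n := N)), fun a => ?_, fun k hk => ?_⟩
  · have := Equiv.Perm.extendDomain_apply_image σ (Fin.equivSubtype (n := N)) (e' a)
    rw [hσ] at this
    exact this
  · exact Equiv.Perm.extendDomain_apply_not_subtype _ _ (by simpa using hk)

theorem perm_lt_of_fixes {N N' : ℕ} (hN : N ≤ N') {π : Equiv.Perm ℕ} (hπ : ∀ k, N ≤ k → π k = k)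
    {k : ℕ} (hk : k < N') : π k < N' := by
  by_contra! h
  have h1 : π k = k := π.injective (hπ _ (hN.trans h))
  omega

/-- The sum of a kernel over all tuples of distinct vertices below `N` of the array `z`. -/
noncomputable def tupleSum (h : (ι → ι → E) → ℝ≥0∞) (N : ℕ) (z : ℕ → ℕ → E) : ℝ≥0∞ :=
  ∑ i : ι ↪ Fin N, h fun a b => z (i a) (i b)

/-- The permutation merely reindexes the tuples. Allowing every `N' ≥ N` makes events about later
averages invariant as well. -/
theorem tupleSum_perm (h : (ι → ι → E) → ℝ≥0∞) {N N' : ℕ} (hN : N ≤ N') {π : Equiv.Perm ℕ}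
    (hπ : ∀ k, N ≤ k → π k = k) (z : ℕ → ℕ → E) :
    tupleSum h N' (fun i j => z (π i) (π j)) = tupleSum h N' z := by
  have hs : ∀ k, N ≤ k → π.symm k = k := fun k hk => by
    rw [Equiv.symm_apply_eq, hπ k hk]
  let σ : Equiv.Perm (Fin N') :=
    { toFun := fun k => ⟨π k, perm_lt_of_fixes hN hπ k.2⟩
      invFun := fun k => ⟨π.symm k, perm_lt_of_fixes hN hs k.2⟩
      left_inv := fun k => by simp
      right_inv := fun k => by simp }
  exact Fintype.sum_equiv (Equiv.embeddingCongr (Equiv.refl ι) σ) _ _ fun i => rfl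

variable [MeasurableSpace E]

omit [Fintype ι] in
theorem measurable_kernel_comp {h : (ι → ι → E) → ℝ≥0∞} (hm : Measurable h) (e : ι → ℕ) :
    Measurable fun z : ℕ → ℕ → E => h fun a b => z (e a) (e b) := by
  refine hm.comp ?_
  fun_prop

theorem measurable_tupleSum {h : (ι → ι → E) → ℝ≥0∞} (hm : Measurable h) (N : ℕ) :
    Measurable (tupleSum h N) :=
  Finset.measurable_sum _ fun i _ => measurable_kernel_comp hm fun a => (i a : ℕ)

variable {Q : Measure (ℕ → ℕ → E)}
  (hQ : ∀ π : Equiv.Perm ℕ, MeasurePreserving (fun (z : ℕ → ℕ → E) i j => z (π i) (π j)) Q Q)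
include hQ

/-- On an event that is invariant under the permutations of the numbers below `N`, the average of
a kernel over the tuples below `N` has the same integral as the kernel at any one tuple. -/
theorem setLIntegral_tupleSum {h : (ι → ι → E) → ℝ≥0∞} (hm : Measurable h) {e : ι → ℕ}
    (he : Function.Injective e) {N : ℕ} (heN : ∀ a, e a < N) {S : Set (ℕ → ℕ → E)}
    (hS : MeasurableSet S)
    (hinv : ∀ π : Equiv.Perm ℕ, (∀ k, N ≤ k → π k = k) →
      (fun (z : ℕ → ℕ → E) i j => z (π i) (π j)) ⁻¹' S = S) :
    ∫⁻ z in S, tupleSum h N z ∂Q =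
      Fintype.card (ι ↪ Fin N) * ∫⁻ z in S, h (fun a b => z (e a) (e b)) ∂Q := by
  unfold tupleSum
  rw [lintegral_finsetSum _ fun i _ => measurable_kernel_comp hm fun a => (i a : ℕ)]
  rw [Finset.sum_congr rfl (g := fun _ => ∫⁻ z in S, h (fun a b => z (e a) (e b)) ∂Q)]
  · simp
  · intro i _
    obtain ⟨π, hπ, hfix⟩ := exists_perm_extending e he heN i
    have := (hQ π).setLIntegral_comp_preimage hS (measurable_kernel_comp hm e)
    rw [hinv π hfix] at this
    simpa only [hπ] using this

/-- The maximal inequality for averages of a nonnegative kernel over a jointly exchangeable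
array. -/
theorem exchangeable_maximal_inequality {h : (ι → ι → E) → ℝ≥0∞} (hm : Measurable h) {e : ι → ℕ}
    (he : Function.Injective e) {n : ℕ} (hen : ∀ a, e a < n) (c : ℝ≥0∞) :
    c * Q {z | ∃ N ≥ n, c * Fintype.card (ι ↪ Fin N) < tupleSum h N z} ≤
      ∫⁻ z, h (fun a b => z (e a) (e b)) ∂Q := by
  have hexc (N : ℕ) : MeasurableSet {z | c * Fintype.card (ι ↪ Fin N) < tupleSum h N z} :=
    measurableSet_lt measurable_const (measurable_tupleSum hm N)
  have key (M : ℕ) : c * Q {z | ∃ N ∈ Finset.Icc n M,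
      c * Fintype.card (ι ↪ Fin N) < tupleSum h N z} ≤
        ∫⁻ z, h (fun a b => z (e a) (e b)) ∂Q := by
    -- `S N` says that `N` is the last exceedance time up to `M`. It involves only tuple sums at
    -- times at least `N`, hence is invariant under permutations of the numbers below `N`; this is
    -- the reverse-martingale form of the maximal inequality.
    let S (N : ℕ) : Set (ℕ → ℕ → E) := {z | c * Fintype.card (ι ↪ Fin N) < tupleSum h N z} ∩
      ⋂ N' ∈ Finset.Ioc N M, {z | c * Fintype.card (ι ↪ Fin N') < tupleSum h N' z}ᶜ
    have hSm (N : ℕ) : MeasurableSet (S N) :=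
      (hexc N).inter (Finset.measurableSet_biInter _ fun N' _ => (hexc N').compl)
    have hSd : Set.PairwiseDisjoint (Finset.Icc n M : Set ℕ) S := by
      have aux : ∀ N N', N < N' → N' ≤ M → Disjoint (S N) (S N') := by
        intro N N' hlt hM
        rw [Set.disjoint_left]
        intro z h1 h2
        have := Set.mem_iInter₂.1 h1.2 N' (by simp [hlt, hM])
        exact this h2.1
      intro N hN N' hN' hne
      simp only [Finset.coe_Icc, Set.mem_Icc] at hN hN'
      rcases lt_or_gt_of_ne hne with hlt | hlt
      · exact aux _ _ hlt hN'.2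
      · exact (aux _ _ hlt hN.2).symm
    have hsub : {z | ∃ N ∈ Finset.Icc n M, c * Fintype.card (ι ↪ Fin N) < tupleSum h N z} ⊆
        ⋃ N ∈ Finset.Icc n M, S N := by
      classical
      rintro z ⟨N₀, hN₀, hz⟩
      let F := (Finset.Icc n M).filter fun N => c * Fintype.card (ι ↪ Fin N) < tupleSum h N z
      have hF : F.Nonempty := ⟨N₀, by simp only [F, Finset.mem_filter]; exact ⟨hN₀, hz⟩⟩
      have hmax := F.max'_mem hF
      have hmax' := Finset.mem_filter.1 hmax
      refine Set.mem_iUnion₂.2 ⟨F.max' hF, hmax'.1, hmax'.2, Set.mem_iInter₂.2 ?_⟩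
      intro N' hN' hz'
      have h1 := Finset.mem_Icc.1 hmax'.1
      have h2 := Finset.mem_Ioc.1 hN'
      have : N' ∈ F := Finset.mem_filter.2 ⟨Finset.mem_Icc.2 ⟨by omega, h2.2⟩, hz'⟩
      have := F.le_max' N' this
      omega
    have hbound : ∀ N ∈ Finset.Icc n M,
        c * Q (S N) ≤ ∫⁻ z in S N, h (fun a b => z (e a) (e b)) ∂Q := by
      intro N hN
      have hnN := (Finset.mem_Icc.1 hN).1
      have heN : ∀ a, e a < N := fun a => (hen a).trans_le hnN
      let i₀ : ι ↪ Fin N := ⟨fun a => ⟨e a, heN a⟩, fun a b hab => he (by simpa using hab)⟩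
      have hcard : (Fintype.card (ι ↪ Fin N) : ℝ≥0∞) ≠ 0 := by
        have : Nonempty (ι ↪ Fin N) := ⟨i₀⟩
        exact Nat.cast_ne_zero.2 Fintype.card_ne_zero
      have hinv : ∀ π : Equiv.Perm ℕ, (∀ k, N ≤ k → π k = k) →
          (fun (z : ℕ → ℕ → E) i j => z (π i) (π j)) ⁻¹' (S N) = S N := by
        intro π hπ
        ext z
        simp only [S, Set.mem_preimage, Set.mem_inter_iff, Set.mem_iInter, Set.mem_compl_iff,
          Set.mem_ofPred_eq, tupleSum_perm h le_rfl hπ]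
        refine and_congr Iff.rfl (forall₂_congr fun N' hN' => ?_)
        rw [tupleSum_perm h (Finset.mem_Ioc.1 hN').1.le hπ]
      have h1 : (Fintype.card (ι ↪ Fin N) : ℝ≥0∞) * (c * Q (S N)) ≤
          Fintype.card (ι ↪ Fin N) * ∫⁻ z in S N, h (fun a b => z (e a) (e b)) ∂Q := by
        rw [← setLIntegral_tupleSum hQ hm he heN (hSm N) hinv, ← mul_assoc, mul_comm _ c,
          ← setLIntegral_const]
        exact setLIntegral_mono (measurable_tupleSum hm N) fun z hz => hz.1.le
      exact (ENNReal.mul_le_mul_iff_right hcard (ENNReal.natCast_ne_top _)).1 h1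
    calc c * Q {z | ∃ N ∈ Finset.Icc n M, c * Fintype.card (ι ↪ Fin N) < tupleSum h N z}
        ≤ c * ∑ N ∈ Finset.Icc n M, Q (S N) := by
          gcongr
          exact (measure_mono hsub).trans (measure_biUnion_finset_le _ _)
      _ = ∑ N ∈ Finset.Icc n M, c * Q (S N) := Finset.mul_sum _ _ _
      _ ≤ ∑ N ∈ Finset.Icc n M, ∫⁻ z in S N, h (fun a b => z (e a) (e b)) ∂Q :=
          Finset.sum_le_sum hbound
      _ = ∫⁻ z in ⋃ N ∈ Finset.Icc n M, S N, h (fun a b => z (e a) (e b)) ∂Q :=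
          (lintegral_biUnion_finset hSd (fun N _ => hSm N) _).symm
      _ ≤ _ := setLIntegral_le_lintegral _ _
  have hU : {z | ∃ N ≥ n, c * Fintype.card (ι ↪ Fin N) < tupleSum h N z} =
      ⋃ M : ℕ, {z | ∃ N ∈ Finset.Icc n M, c * Fintype.card (ι ↪ Fin N) < tupleSum h N z} := by
    ext z
    simp only [Set.mem_iUnion, Set.mem_ofPred_eq, Finset.mem_Icc]
    constructor
    · rintro ⟨N, hN, hz⟩
      exact ⟨N, N, ⟨hN, le_rfl⟩, hz⟩
    · rintro ⟨M, N, hN, hz⟩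
      exact ⟨N, hN.1, hz⟩
  have hmono : Monotone fun M : ℕ =>
      {z | ∃ N ∈ Finset.Icc n M, c * Fintype.card (ι ↪ Fin N) < tupleSum h N z} := by
    rintro M M' hM z ⟨N, hN, hz⟩
    have := Finset.mem_Icc.1 hN
    exact ⟨N, Finset.mem_Icc.2 ⟨this.1, this.2.trans hM⟩, hz⟩
  rw [hU, hmono.measure_iUnion, ENNReal.mul_iSup]
  exact iSup_le key

end Exchangeable

end NCCLT

namespace NCCLT

/-! ### Strong law for bounded families in which only overlapping tuples are correlated. -/

section Dissociated

variable {ι : Type*}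

/-- Two tuples have at least two entries in common. -/
def SharesTwo {α : Type*} (i i' : ι → α) : Prop :=
  ∃ a b a' b', a ≠ b ∧ i a = i' a' ∧ i b = i' b'

variable [Fintype ι]

/-- Two entries of the second tuple are determined by the first, so overwriting them with arbitrary
values is injective and gains a factor `N ^ 2`. -/
theorem card_sharing_given_positions_mul_sq_le [DecidableEq ι] (N : ℕ) (a b a' b' : ι)
    (h : a' ≠ b') :
    (Finset.univ.filter fun x : (ι → Fin N) × (ι → Fin N) =>
      x.1 a = x.2 a' ∧ x.1 b = x.2 b').card * N ^ 2 ≤ N ^ (2 * Fintype.card ι) := by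
  let B := Finset.univ.filter fun x : (ι → Fin N) × (ι → Fin N) =>
      x.1 a = x.2 a' ∧ x.1 b = x.2 b'
  let F : B × (Fin N × Fin N) → (ι → Fin N) × (ι → Fin N) := fun x =>
    (x.1.1.1, Function.update (Function.update x.1.1.2 a' x.2.1) b' x.2.2)
  have hF : Function.Injective F := by
    rintro ⟨⟨⟨i, i'⟩, hi⟩, x, y⟩ ⟨⟨⟨j, j'⟩, hj⟩, x', y'⟩ hxy
    simp only [B, Finset.mem_filter, Finset.mem_univ, true_and] at hi hj
    simp only [F, Prod.mk.injEq] at hxy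
    obtain ⟨rfl, h2⟩ := hxy
    have hy : y = y' := by simpa using congrFun h2 b'
    have hx : x = x' := by simpa [h] using congrFun h2 a'
    have hij : i' = j' := by
      funext c
      by_cases hcb : c = b'
      · rw [hcb, ← hi.2, ← hj.2]
      by_cases hca : c = a'
      · rw [hca, ← hi.1, ← hj.1]
      simpa [hcb, hca] using congrFun h2 c
    subst hx hy hij
    rfl
  have := Fintype.card_le_of_injective F hF
  simp only [Fintype.card_prod, Fintype.card_coe, Fintype.card_fin, Fintype.card_fun] at this
  calc B.card * N ^ 2 = B.card * (N * N) := by ring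
    _ ≤ _ := this
    _ = _ := by ring

open Classical in
theorem card_sharesTwo_mul_sq_le (N : ℕ) :
    (Finset.univ.filter fun x : (ι ↪ Fin N) × (ι ↪ Fin N) => SharesTwo x.1 x.2).card * N ^ 2 ≤
      Fintype.card ι ^ 4 * N ^ (2 * Fintype.card ι) := by
  let T : Finset (ι × ι × ι × ι) := Finset.univ.filter fun x => x.2.2.1 ≠ x.2.2.2
  let B (x : ι × ι × ι × ι) := Finset.univ.filter fun y : (ι → Fin N) × (ι → Fin N) =>
      y.1 x.1 = y.2 x.2.2.1 ∧ y.1 x.2.1 = y.2 x.2.2.2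
  have h1 : (Finset.univ.filter fun x : (ι ↪ Fin N) × (ι ↪ Fin N) => SharesTwo x.1 x.2).card ≤
      (T.biUnion B).card := by
    refine Finset.card_le_card_of_injOn (fun x => (⇑x.1, ⇑x.2)) ?_ ?_
    · rintro ⟨i, i'⟩ hx
      obtain ⟨a, b, a', b', hab, h1, h2⟩ := (Finset.mem_filter.1 hx).2
      simp only [Finset.coe_biUnion, Set.mem_iUnion]
      refine ⟨(a, b, a', b'), ?_, ?_⟩
      · simp only [T, Finset.coe_filter, Finset.mem_univ, true_and, Set.mem_ofPred_eq]
        rintro rfl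
        exact hab (i.injective (h1.trans h2.symm))
      · simpa [B] using ⟨h1, h2⟩
    · rintro ⟨i, i'⟩ - ⟨j, j'⟩ - h
      simp only [Prod.mk.injEq, DFunLike.coe_fn_eq] at h
      exact Prod.ext h.1 h.2
  have hT : T.card ≤ Fintype.card ι ^ 4 := by
    refine (Finset.card_le_univ T).trans (le_of_eq ?_)
    simp only [Fintype.card_prod]
    ring
  calc _ ≤ (T.biUnion B).card * N ^ 2 := Nat.mul_le_mul_right _ h1
    _ ≤ (∑ x ∈ T, (B x).card) * N ^ 2 := Nat.mul_le_mul_right _ Finset.card_biUnion_le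
    _ = ∑ x ∈ T, (B x).card * N ^ 2 := Finset.sum_mul _ _ _
    _ ≤ ∑ x ∈ T, N ^ (2 * Fintype.card ι) := Finset.sum_le_sum fun x hx =>
        card_sharing_given_positions_mul_sq_le N _ _ _ _ (Finset.mem_filter.1 hx).2
    _ ≤ _ := by
        rw [Finset.sum_const, smul_eq_mul]
        exact Nat.mul_le_mul_right _ hT

variable {Ω : Type*} [MeasurableSpace Ω] {P : Measure Ω} [IsProbabilityMeasure P]

omit [IsProbabilityMeasure P] in
/-- A sequence of random variables whose second moments are summable tends to zero almost surely. -/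
theorem ae_tendsto_zero_of_integral_sq_le {X : ℕ → Ω → ℝ} (hX : ∀ N, Measurable (X N))
    (hint : ∀ N, Integrable (fun ω => X N ω ^ 2) P) {c : ℕ → ℝ} (hc : Summable c)
    (hle : ∀ N, ∫ ω, X N ω ^ 2 ∂P ≤ c N) :
    ∀ᵐ ω ∂P, Tendsto (fun N => X N ω) atTop (𝓝 0) := by
  have hc0 : ∀ N, 0 ≤ c N := fun N => (integral_nonneg fun ω => sq_nonneg _).trans (hle N)
  have hm : ∀ N, Measurable fun ω => ENNReal.ofReal (X N ω ^ 2) := fun N =>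
    ((hX N).pow_const 2).ennreal_ofReal
  have h1 : ∫⁻ ω, ∑' N, ENNReal.ofReal (X N ω ^ 2) ∂P ≠ ⊤ := by
    rw [lintegral_tsum fun N => (hm N).aemeasurable]
    refine ne_top_of_le_ne_top hc.tsum_ofReal_ne_top (ENNReal.tsum_le_tsum fun N => ?_)
    rw [← ofReal_integral_eq_lintegral_ofReal (hint N) (ae_of_all _ fun ω => sq_nonneg _)]
    exact ENNReal.ofReal_le_ofReal (hle N)
  filter_upwards [ae_lt_top (Measurable.tsum hm) h1] with ω hω
  have h2 := ENNReal.tendsto_atTop_zero_of_tsum_ne_top hω.ne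
  have h3 := (ENNReal.tendsto_toReal ENNReal.zero_ne_top).comp h2
  have h4 : Tendsto (fun N => X N ω ^ 2) atTop (𝓝 0) := by
    refine h3.congr fun N => ?_
    simp [ENNReal.toReal_ofReal (sq_nonneg _)]
  have h5 := h4.sqrt
  simp only [Real.sqrt_sq_eq_abs, Real.sqrt_zero] at h5
  exact (tendsto_zero_iff_abs_tendsto_zero _).2 h5

/-- The strong law of large numbers for a bounded family of random variables indexed by tuples in
which the variables of two tuples with at most one common entry are independent. -/
theorem ae_tendsto_of_dissociated {Y : (ι → ℕ) → Ω → ℝ} (hY : ∀ i, Measurable (Y i)) {K : ℝ}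
    (hK : ∀ i ω, |Y i ω| ≤ K)
    (hind : ∀ i i', Function.Injective i → Function.Injective i' → ¬ SharesTwo i i' →
      IndepFun (Y i) (Y i') P) :
    ∀ᵐ ω ∂P, Tendsto (fun N : ℕ => (∑ i : ι ↪ Fin N, (Y (fun a => i a) ω -
      ∫ ω', Y (fun a => i a) ω' ∂P)) / (N : ℝ) ^ Fintype.card ι) atTop (𝓝 0) := by
  classical
  have hYint : ∀ i, Integrable (Y i) P := fun i =>
    Integrable.of_bound (hY i).aestronglyMeasurable K (ae_of_all _ fun ω => by simpa using hK i ω)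
  set X : (ι → ℕ) → Ω → ℝ := fun i ω => Y i ω - ∫ ω', Y i ω' ∂P with hXdef
  have hX : ∀ i, Measurable (X i) := fun i => (hY i).sub_const _
  have hXb : ∀ i ω, |X i ω| ≤ 2 * K := by
    intro i ω
    have h1 : |∫ ω', Y i ω' ∂P| ≤ K := by
      have := norm_integral_le_of_norm_le_const (μ := P) (f := Y i) (C := K)
        (ae_of_all _ fun ω => by simpa using hK i ω)
      simpa using this
    have := abs_sub (Y i ω) (∫ ω', Y i ω' ∂P)
    have h2 := hK i ω
    simp only [hXdef]
    linarith
  have hXXint : ∀ i i', Integrable (fun ω => X i ω * X i' ω) P := fun i i' =>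
    Integrable.of_bound ((hX i).mul (hX i')).aestronglyMeasurable (2 * K * (2 * K))
      (ae_of_all _ fun ω => by
        rw [norm_mul]
        exact mul_le_mul (hXb i ω) (hXb i' ω) (norm_nonneg _) ((abs_nonneg _).trans (hXb i ω)))
  have hX0 : ∀ i, ∫ ω, X i ω ∂P = 0 := fun i => by
    simp only [hXdef]
    rw [integral_sub (hYint i) (integrable_const _)]
    simp
  have hcov : ∀ i i', Function.Injective i → Function.Injective i' →
      ∫ ω, X i ω * X i' ω ∂P ≤ if SharesTwo i i' then 4 * K ^ 2 else 0 := by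
    intro i i' hi hi'
    split_ifs with h
    · calc ∫ ω, X i ω * X i' ω ∂P ≤ ∫ ω, 4 * K ^ 2 ∂P := by
            refine integral_mono (hXXint i i') (integrable_const _) fun ω => ?_
            have h1 := abs_le.1 (hXb i ω)
            have h2 := abs_le.1 (hXb i' ω)
            have h3 : |X i ω * X i' ω| ≤ 2 * K * (2 * K) := by
              rw [abs_mul]
              exact mul_le_mul (hXb i ω) (hXb i' ω) (abs_nonneg _)
                ((abs_nonneg _).trans (hXb i ω))
            have h4 := (abs_le.1 h3).2
            simp only
            linarith
        _ = _ := by simp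
    · have hI : IndepFun (X i) (X i') P :=
        (hind i i' hi hi' h).comp (measurable_id.sub_const (∫ ω', Y i ω' ∂P))
          (measurable_id.sub_const (∫ ω', Y i' ω' ∂P))
      rw [hI.integral_fun_mul_eq_mul_integral (hX i).aestronglyMeasurable
        (hX i').aestronglyMeasurable, hX0, zero_mul]
  set n := Fintype.card ι
  have hsq : ∀ (N : ℕ) (ω : Ω), (∑ i : ι ↪ Fin N, X (fun a => i a) ω) ^ 2 =
      ∑ x : (ι ↪ Fin N) × (ι ↪ Fin N), X (fun a => x.1 a) ω * X (fun a => x.2 a) ω := by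
    intro N ω
    rw [sq, Finset.sum_mul_sum, Fintype.sum_prod_type]
  have hsqint : ∀ N : ℕ, Integrable (fun ω => (∑ i : ι ↪ Fin N, X (fun a => i a) ω) ^ 2) P := by
    intro N
    simp only [hsq]
    exact integrable_finsetSum _ fun x _ => hXXint _ _
  have hval : ∀ {N : ℕ} (i : ι ↪ Fin N), Function.Injective fun a => (i a : ℕ) := fun i =>
    Fin.val_injective.comp i.injective
  -- Pairs of tuples sharing at most one entry have zero covariance, so only a fraction of order `1
  -- / N ^ 2` of all pairs contributes. That is summable, and no subsequence argument is needed.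
  have hvar : ∀ N : ℕ, (∫ ω, (∑ i : ι ↪ Fin N, X (fun a => i a) ω) ^ 2 ∂P) * N ^ 2 ≤
      4 * K ^ 2 * n ^ 4 * N ^ (2 * n) := by
    intro N
    have h1 : ∫ ω, (∑ i : ι ↪ Fin N, X (fun a => i a) ω) ^ 2 ∂P ≤
        (Finset.univ.filter fun x : (ι ↪ Fin N) × (ι ↪ Fin N) => SharesTwo x.1 x.2).card *
          (4 * K ^ 2) := by
      simp only [hsq]
      rw [integral_finsetSum _ fun x _ => hXXint _ _, ← nsmul_eq_mul, ← Finset.sum_const,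
        Finset.sum_filter]
      refine Finset.sum_le_sum fun x _ => (hcov _ _ (hval x.1) (hval x.2)).trans (le_of_eq ?_)
      have : SharesTwo (fun a => (x.1 a : ℕ)) (fun a => (x.2 a : ℕ)) ↔ SharesTwo x.1 x.2 := by
        simp only [SharesTwo, Fin.val_inj]
      simp only [this]
    have h2 : ((Finset.univ.filter fun x : (ι ↪ Fin N) × (ι ↪ Fin N) =>
        SharesTwo x.1 x.2).card : ℝ) * N ^ 2 ≤ n ^ 4 * N ^ (2 * n) := by
      exact_mod_cast card_sharesTwo_mul_sq_le (ι := ι) N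
    calc _ ≤ _ := mul_le_mul_of_nonneg_right h1 (by positivity)
      _ = 4 * K ^ 2 * (((Finset.univ.filter fun x : (ι ↪ Fin N) × (ι ↪ Fin N) =>
        SharesTwo x.1 x.2).card : ℝ) * N ^ 2) := by ring
      _ ≤ 4 * K ^ 2 * (n ^ 4 * N ^ (2 * n)) := by gcongr
      _ = _ := by ring
  -- The shift to `N + 1` keeps the denominators nonzero.
  have hshift : ∀ᵐ ω ∂P, Tendsto (fun N : ℕ => (∑ i : ι ↪ Fin (N + 1), X (fun a => i a) ω) /
      ((N + 1 : ℕ) : ℝ) ^ n) atTop (𝓝 0) := by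
    refine ae_tendsto_zero_of_integral_sq_le (c := fun N => 4 * K ^ 2 * n ^ 4 *
      (1 / ((N + 1 : ℕ) : ℝ) ^ 2)) (fun N => ?_) (fun N => ?_) ?_ fun N => ?_
    · exact (Finset.measurable_fun_sum _ fun i _ => hX _).div_const _
    · simp only [div_pow]
      exact (hsqint (N + 1)).div_const _
    · exact ((summable_nat_add_iff 1).2 (Real.summable_one_div_nat_pow.2 one_lt_two)).mul_left _
    · simp only [div_pow, integral_div]
      have hpos : (0 : ℝ) < (N + 1 : ℕ) := by positivity
      rw [div_le_iff₀ (by positivity), mul_one_div, div_mul_eq_mul_div,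
        le_div_iff₀ (by positivity), ← pow_mul, mul_comm n 2]
      exact hvar (N + 1)
  filter_upwards [hshift] with ω hω
  exact (tendsto_add_atTop_iff_nat 1).1 hω

end Dissociated

end NCCLT

namespace NCCLT

/-! ### Symmetric arrays indexed by increasing pairs. -/

/-- The index set `{(i, j) | i < j}`. -/
abbrev IncPair : Type := {p : ℕ × ℕ // p.1 < p.2}

/-- The symmetric array with entries `x (i, j)`, `i < j`, and zero diagonal. -/
def symmExtend (x : IncPair → ℝ) (i j : ℕ) : ℝ :=
  if h : i < j then x ⟨(i, j), h⟩ else if h : j < i then x ⟨(j, i), h⟩ else 0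

/-- The increasing pair with the given distinct entries. -/
def incPair (i j : ℕ) (h : i ≠ j) : IncPair := ⟨(min i j, max i j), min_lt_max.2 h⟩

theorem symmExtend_eq (x : IncPair → ℝ) {i j : ℕ} (h : i ≠ j) :
    symmExtend x i j = x (incPair i j h) := by
  unfold symmExtend incPair
  rcases lt_or_gt_of_ne h with h' | h'
  · simp [h', h'.le]
  · simp [h', h'.le, h'.not_gt]

theorem incPair_eq_iff {i j k l : ℕ} (h : i ≠ j) (h' : k ≠ l) :
    incPair i j h = incPair k l h' ↔ (i = k ∧ j = l) ∨ (i = l ∧ j = k) := by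
  simp only [incPair, Subtype.mk.injEq, Prod.mk.injEq]
  omega

theorem measurable_symmExtend : Measurable symmExtend := by
  refine measurable_pi_iff.2 fun i => measurable_pi_iff.2 fun j => ?_
  unfold symmExtend
  split_ifs <;> fun_prop

/-- The action of a permutation of `ℕ` on increasing pairs. -/
def permPair (π : Equiv.Perm ℕ) (p : IncPair) : IncPair :=
  incPair (π p.1.1) (π p.1.2) (π.injective.ne p.2.ne)

theorem permPair_injective (π : Equiv.Perm ℕ) : Function.Injective (permPair π) := by
  rintro ⟨⟨i, j⟩, h⟩ ⟨⟨k, l⟩, h'⟩ e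
  simp only [permPair, incPair_eq_iff, EmbeddingLike.apply_eq_iff_eq] at e
  simp only [Subtype.mk.injEq, Prod.mk.injEq]
  dsimp only at h h'
  omega

theorem symmExtend_permPair (π : Equiv.Perm ℕ) (x : IncPair → ℝ) (i j : ℕ) :
    symmExtend (fun p => x (permPair π p)) i j = symmExtend x (π i) (π j) := by
  by_cases h : i = j
  · simp [symmExtend, h]
  · rw [symmExtend_eq _ h, symmExtend_eq _ (π.injective.ne h)]
    congr 1
    rw [permPair, incPair_eq_iff]
    rcases lt_or_gt_of_ne h with h' | h' <;> simp [incPair, h'.le]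

/-! ### Strong laws for symmetric i.i.d. arrays. -/

section IID

variable {Ω : Type*} [MeasurableSpace Ω] {P : Measure Ω} {X : IncPair → Ω → ℝ}

theorem measurable_symmExtend_comp (hX : ∀ p, Measurable (X p)) :
    Measurable fun ω => symmExtend fun p => X p ω :=
  measurable_symmExtend.comp (measurable_pi_iff.2 hX)

/-- The symmetric array of an i.i.d. family is jointly exchangeable. -/
theorem measurePreserving_perm_symmExtend (hX : ∀ p, Measurable (X p)) (hind : iIndepFun X P)
    (hid : ∀ p p', IdentDistrib (X p) (X p') P P) (π : Equiv.Perm ℕ) :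
    MeasurePreserving (fun (z : ℕ → ℕ → ℝ) i j => z (π i) (π j))
      (P.map fun ω => symmExtend fun p => X p ω) (P.map fun ω => symmExtend fun p => X p ω) := by
  have hm : Measurable fun (z : ℕ → ℕ → ℝ) i j => z (π i) (π j) := by fun_prop
  refine ⟨hm, ?_⟩
  rw [Measure.map_map hm (measurable_symmExtend_comp hX)]
  have h1 : IdentDistrib (fun ω p => X (permPair π p) ω) (fun ω p => X p ω) P P :=
    IdentDistrib.pi (X := fun p => X (permPair π p)) (Y := X) (fun p => hid _ _)
      (hind.precomp (permPair_injective π)) hind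
  have h2 := (h1.comp measurable_symmExtend).map_eq
  rw [show ((fun (z : ℕ → ℕ → ℝ) i j => z (π i) (π j)) ∘ fun ω => symmExtend fun p => X p ω) =
    symmExtend ∘ fun ω p => X (permPair π p) ω from ?_]
  · exact h2
  · funext ω i j
    exact (symmExtend_permPair π (fun p => X p ω) i j).symm

variable {ι : Type*} [Fintype ι]

/-- Functions of an i.i.d. array restricted to two tuples with at most one common entry are
independent. -/
theorem indepFun_of_not_sharesTwo (hX : ∀ p, Measurable (X p)) (hind : iIndepFun X P)
    {F F' : (ι → ι → ℝ) → ℝ} (hF : Measurable F) (hF' : Measurable F') {i i' : ι → ℕ} (h : ¬ SharesTwo i i') :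
    IndepFun (fun ω => F fun a b => symmExtend (fun p => X p ω) (i a) (i b))
      (fun ω => F' fun a b => symmExtend (fun p => X p ω) (i' a) (i' b)) P := by
  classical
  -- The coordinates that a kernel reads along the tuple `i`. A coordinate read along both tuples
  -- would give them two common vertices, so here the two sets are disjoint.
  let S (i : ι → ℕ) : Finset IncPair :=
    Finset.univ.biUnion fun x : ι × ι =>
      if h : i x.1 ≠ i x.2 then {incPair (i x.1) (i x.2) h} else ∅
  have hmem : ∀ (i : ι → ℕ) (a b : ι) (h : i a ≠ i b), incPair (i a) (i b) h ∈ S i := by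
    intro i a b h
    refine Finset.mem_biUnion.2 ⟨(a, b), Finset.mem_univ _, ?_⟩
    simp [h]
  have hmem' : ∀ (i : ι → ℕ) (p : IncPair), p ∈ S i →
      ∃ a b, ∃ h : i a ≠ i b, p = incPair (i a) (i b) h := by
    intro i p hp
    obtain ⟨x, -, hx⟩ := Finset.mem_biUnion.1 hp
    split_ifs at hx with h
    · exact ⟨x.1, x.2, h, Finset.mem_singleton.1 hx⟩
    · simp at hx
  have hdisj : Disjoint (S i) (S i') := by
    rw [Finset.disjoint_left]
    intro p hp hp'
    obtain ⟨a, b, hab, rfl⟩ := hmem' i p hp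
    obtain ⟨a', b', hab', he⟩ := hmem' i' _ hp'
    refine h ?_
    have hne : a ≠ b := fun e => hab (by rw [e])
    rcases (incPair_eq_iff _ _).1 he with ⟨h1, h2⟩ | ⟨h1, h2⟩
    · exact ⟨a, b, a', b', hne, h1, h2⟩
    · exact ⟨a, b, b', a', hne, h1, h2⟩
  let G (i : ι → ℕ) (y : S i → ℝ) (a b : ι) : ℝ :=
    if h : i a ≠ i b then y ⟨incPair (i a) (i b) h, hmem i a b h⟩ else 0
  have hG : ∀ i, Measurable (G i) := by
    intro i
    refine measurable_pi_iff.2 fun a => measurable_pi_iff.2 fun b => ?_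
    simp only [G]
    split_ifs <;> fun_prop
  have hGX : ∀ i ω, G i (fun p : S i => X p ω) =
      fun a b => symmExtend (fun p => X p ω) (i a) (i b) := by
    intro i ω
    funext a b
    by_cases h : i a = i b
    · simp [G, h, symmExtend]
    · simp [G, h, symmExtend_eq]
  have := (hind.indepFun_finset (S i) (S i') hdisj hX).comp (hF.comp (hG i)) (hF'.comp (hG i'))
  simpa only [Function.comp_def, hGX] using this

theorem tendsto_card_embedding_div_pow :
    Tendsto (fun N : ℕ => (Fintype.card (ι ↪ Fin N) : ℝ) / (N : ℝ) ^ Fintype.card ι)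
      atTop (𝓝 1) := by
  have h := isEquivalent_descFactorial (Fintype.card ι)
  rw [Asymptotics.isEquivalent_iff_tendsto_one] at h
  · refine h.congr fun N => ?_
    simp [Fintype.card_embedding_eq]
  · filter_upwards [eventually_gt_atTop 0] with N hN
    positivity

/-- The strong law of large numbers for averages of a kernel over tuples of distinct vertices in a
symmetric i.i.d. array. The kernel may depend on the tuple, but its mean may not. -/
theorem ae_tendsto_kernel_average [IsProbabilityMeasure P] (hX : ∀ p, Measurable (X p))
    (hind : iIndepFun X P) (hid : ∀ p p', IdentDistrib (X p) (X p') P P)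
    {f : (ι → ℕ) → (ι → ι → ℝ) → ℝ} (hf : ∀ i, Measurable (f i))
    {D : (ι → ι → ℝ) → ℝ} (hD : Measurable D) (hfD : ∀ i x, |f i x| ≤ D x)
    (hDint : ∀ i : ι → ℕ, Function.Injective i →
      Integrable (fun ω => D fun a b => symmExtend (fun p => X p ω) (i a) (i b)) P)
    {m : ℝ} (hm : ∀ i : ι → ℕ, Function.Injective i →
      ∫ ω, f i (fun a b => symmExtend (fun p => X p ω) (i a) (i b)) ∂P = m) :
    ∀ᵐ ω ∂P, Tendsto (fun N : ℕ => (∑ i : ι ↪ Fin N,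
      f (fun a => i a) fun a b => symmExtend (fun p => X p ω) (i a) (i b)) /
        (N : ℝ) ^ Fintype.card ι) atTop (𝓝 m) := by
  classical
  set Z : Ω → ℕ → ℕ → ℝ := fun ω => symmExtend fun p => X p ω with hZdef
  have hZ : Measurable Z := measurable_symmExtend_comp hX
  have hZi : ∀ i : ι → ℕ, Measurable fun ω => fun a b => Z ω (i a) (i b) := by
    intro i
    have : Measurable fun (z : ℕ → ℕ → ℝ) (a b : ι) => z (i a) (i b) := by fun_prop
    exact this.comp hZ
  set n := Fintype.card ι
  let e : ι → ℕ := fun a => Fintype.equivFin ι a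
  have he : Function.Injective e := Fin.val_injective.comp (Fintype.equivFin ι).injective
  have hen : ∀ a, e a < n := fun a => (Fintype.equivFin ι a).2
  have hD0 : ∀ x, 0 ≤ D x := fun x => (abs_nonneg _).trans (hfD e x)
  -- Truncation is by the envelope `D`, not by `f i`, so that the error is bounded by the single
  -- kernel `h K`, the tail of `D`, for all tuples at once.
  let fK (K : ℕ) (i : ι → ℕ) (x : ι → ι → ℝ) : ℝ := if D x ≤ K then f i x else 0
  let h (K : ℕ) (x : ι → ι → ℝ) : ℝ≥0∞ := if D x ≤ K then 0 else ENNReal.ofReal (D x)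
  have hset : ∀ K : ℕ, MeasurableSet {x | D x ≤ K} := fun K =>
    measurableSet_le hD measurable_const
  have hfK : ∀ K i, Measurable (fK K i) := fun K i =>
    Measurable.ite (hset K) (hf i) measurable_const
  have hh : ∀ K, Measurable (h K) := fun K =>
    Measurable.ite (hset K) measurable_const hD.ennreal_ofReal
  have hfKb : ∀ K i x, |fK K i x| ≤ K := by
    intro K i x
    simp only [fK]
    split_ifs with hx
    · exact (hfD i x).trans hx
    · simp
  have hdiff : ∀ K i x, ENNReal.ofReal |f i x - fK K i x| ≤ h K x := by
    intro K i x
    simp only [fK, h]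
    split_ifs with hx
    · simp
    · simpa using ENNReal.ofReal_le_ofReal (hfD i x)
  have hfint : ∀ i : ι → ℕ, Function.Injective i →
      Integrable (fun ω => f i fun a b => Z ω (i a) (i b)) P := fun i hi =>
    (hDint i hi).mono' ((hf i).comp (hZi i)).aestronglyMeasurable (ae_of_all _ fun ω => hfD i _)
  have hfKint : ∀ K (i : ι → ℕ), Integrable (fun ω => fK K i fun a b => Z ω (i a) (i b)) P :=
    fun K i => Integrable.of_bound ((hfK K i).comp (hZi i)).aestronglyMeasurable K
      (ae_of_all _ fun ω => by simpa using hfKb K i _)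
  set Q := P.map Z with hQdef
  have hQ : ∀ π : Equiv.Perm ℕ,
      MeasurePreserving (fun (z : ℕ → ℕ → ℝ) i j => z (π i) (π j)) Q Q :=
    measurePreserving_perm_symmExtend hX hind hid
  let ε (K : ℕ) : ℝ≥0∞ := ∫⁻ z, h K (fun a b => z (e a) (e b)) ∂Q
  -- By exchangeability the mean of the tail is the same at every injective tuple.
  have hεeq : ∀ K (i : ι → ℕ), Function.Injective i →
      ∫⁻ ω, h K (fun a b => Z ω (i a) (i b)) ∂P = ε K := by
    intro K i hi
    rw [← lintegral_map (measurable_kernel_comp (hh K) i) hZ]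
    obtain ⟨N, hN⟩ : ∃ N, (∀ a, e a < N) ∧ ∀ a, i a < N := by
      refine ⟨n + Finset.univ.sup i + 1, fun a => ?_, fun a => ?_⟩
      · have := hen a
        omega
      · have := Finset.le_sup (f := i) (Finset.mem_univ a)
        omega
    let i' : ι ↪ Fin N := ⟨fun a => ⟨i a, hN.2 a⟩, fun a b hab => hi (by simpa using hab)⟩
    obtain ⟨π, hπ, -⟩ := exists_perm_extending e he hN.1 i'
    have := (hQ π).lintegral_comp (measurable_kernel_comp (hh K) e)
    simp only [hπ] at this
    exact this
  have hε : Tendsto ε atTop (𝓝 0) := by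
    have h0 : Tendsto (fun K => ∫⁻ ω, h K (fun a b => Z ω (e a) (e b)) ∂P) atTop
        (𝓝 (∫⁻ _, 0 ∂P)) := by
      refine tendsto_lintegral_of_dominated_convergence
        (fun ω => ENNReal.ofReal (D fun a b => Z ω (e a) (e b)))
        (fun K => (hh K).comp (hZi e)) (fun K => ae_of_all _ fun ω => ?_) ?_
        (ae_of_all _ fun ω => ?_)
      · simp only [h]
        split_ifs
        · exact zero_le
        · exact le_rfl
      · exact ((hDint e he).lintegral_lt_top).ne
      · refine tendsto_const_nhds.congr' ?_
        filter_upwards [eventually_ge_atTop ⌈D fun a b => Z ω (e a) (e b)⌉₊] with K hK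
        simp only [h]
        rw [if_pos (Nat.ceil_le.1 hK)]
    simpa only [hεeq _ e he, lintegral_zero] using h0
  have hmean : ∀ K (i : ι → ℕ), Function.Injective i → ε K ≠ ⊤ →
      |(∫ ω, fK K i (fun a b => Z ω (i a) (i b)) ∂P) - m| ≤ (ε K).toReal := by
    intro K i hi hfin
    rw [← hm i hi, abs_sub_comm, ← integral_sub (hfint i hi) (hfKint K i)]
    refine (abs_integral_le_integral_abs).trans ?_
    have hmeas : Measurable fun ω =>
        |f i (fun a b => Z ω (i a) (i b)) - fK K i (fun a b => Z ω (i a) (i b))| :=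
      (((hf i).comp (hZi i)).sub ((hfK K i).comp (hZi i))).abs
    rw [integral_eq_lintegral_of_nonneg_ae (ae_of_all _ fun ω => abs_nonneg _)
      hmeas.aestronglyMeasurable]
    refine ENNReal.toReal_mono hfin ?_
    rw [← hεeq K i hi]
    exact lintegral_mono fun ω => hdiff K i _
  have hcentred : ∀ᵐ ω ∂P, ∀ K : ℕ, Tendsto (fun N : ℕ => (∑ i : ι ↪ Fin N,
      (fK K (fun a => i a) (fun a b => Z ω (i a) (i b)) -
        ∫ ω', fK K (fun a => i a) (fun a b => Z ω' (i a) (i b)) ∂P)) / (N : ℝ) ^ n)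
          atTop (𝓝 0) := by
    rw [ae_all_iff]
    intro K
    exact ae_tendsto_of_dissociated (ι := ι)
      (Y := fun i ω => fK K i fun a b => Z ω (i a) (i b)) (fun i => (hfK K i).comp (hZi i))
      (K := K) (fun i ω => hfKb K i _)
      (fun i i' _ _ hs => indepFun_of_not_sharesTwo hX hind (hfK K i) (hfK K i') hs)
  -- The maximal inequality bounds the probability that the tail averages ever exceed `c` by `ε K /
  -- c`, which is below any `δ` for large `K`. Hence it is a null event that every admissible `K`
  -- fails.
  have hmax : ∀ᵐ ω ∂P, ∀ k : ℕ, ∃ K, ε K ≤ ENNReal.ofReal (1 / (k + 1)) ∧ ∀ N ≥ n,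
      tupleSum (h K) N (Z ω) ≤
        ENNReal.ofReal (1 / (k + 1)) * Fintype.card (ι ↪ Fin N) := by
    rw [ae_all_iff]
    intro k
    set c : ℝ≥0∞ := ENNReal.ofReal (1 / (k + 1)) with hc
    have hc0 : c ≠ 0 := by
      rw [hc, Ne, ENNReal.ofReal_eq_zero, not_le]
      positivity
    have hcT : c ≠ ⊤ := ENNReal.ofReal_ne_top
    rw [ae_iff]
    refine le_antisymm (ENNReal.le_of_forall_pos_le_add fun δ hδ _ => ?_) zero_le
    have hev : ∀ᶠ K in atTop, ε K < min c (c * δ) := by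
      refine hε.eventually_lt_const (lt_min (pos_iff_ne_zero.2 hc0) ?_)
      exact ENNReal.mul_pos hc0 (by simpa using hδ.ne')
    obtain ⟨K, hK⟩ := hev.exists
    have hK' := lt_min_iff.1 hK
    have hmeas : MeasurableSet {z : ℕ → ℕ → ℝ |
        ∃ N ≥ n, c * Fintype.card (ι ↪ Fin N) < tupleSum (h K) N z} := by
      have : {z : ℕ → ℕ → ℝ | ∃ N ≥ n, c * Fintype.card (ι ↪ Fin N) < tupleSum (h K) N z} =
          ⋃ N, ⋃ _ : N ≥ n, {z | c * Fintype.card (ι ↪ Fin N) < tupleSum (h K) N z} := by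
        ext z
        simp
      rw [this]
      exact MeasurableSet.iUnion fun N => MeasurableSet.iUnion fun _ =>
        measurableSet_lt measurable_const (measurable_tupleSum (hh K) N)
    have h1 := exchangeable_maximal_inequality hQ (hh K) he hen c
    rw [hQdef, Measure.map_apply hZ hmeas] at h1
    have h2 : c * P (Z ⁻¹' {z | ∃ N ≥ n, c * Fintype.card (ι ↪ Fin N) < tupleSum (h K) N z}) ≤
        c * δ := h1.trans hK'.2.le
    have h3 := (ENNReal.mul_le_mul_iff_right hc0 hcT).1 h2
    rw [zero_add]
    refine (measure_mono ?_).trans h3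
    intro ω hω
    simp only [Set.mem_ofPred_eq, not_exists, not_and, not_forall, not_le] at hω
    obtain ⟨N, hN, hlt⟩ := hω K hK'.1.le
    exact ⟨N, hN, hlt⟩
  filter_upwards [hcentred, hmax] with ω hω1 hω2
  rw [Metric.tendsto_atTop']
  intro η hη
  obtain ⟨k, hk⟩ := exists_nat_one_div_lt (show (0 : ℝ) < η / 4 by positivity)
  obtain ⟨K, hK1, hK2⟩ := hω2 k
  have hεK : (ε K).toReal ≤ 1 / (k + 1) := by
    have := ENNReal.toReal_mono ENNReal.ofReal_ne_top hK1
    rwa [ENNReal.toReal_ofReal (by positivity)] at this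
  have hεfin : ε K ≠ ⊤ := ne_top_of_le_ne_top ENNReal.ofReal_ne_top hK1
  have hev1 := (Metric.tendsto_atTop'.1 (hω1 K)) (η / 4) (by positivity)
  have hcard := (tendsto_card_embedding_div_pow (ι := ι)).const_mul m
  obtain ⟨N₁, hN₁⟩ := hev1
  obtain ⟨N₂, hN₂⟩ := (Metric.tendsto_atTop'.1 hcard) (η / 4) (by positivity)
  refine ⟨max (max N₁ N₂) n, fun N hN => ?_⟩
  have h1 := hN₁ N (by omega)
  have h2 := hN₂ N (by omega)
  have h3 := hK2 N (by omega)
  have hNpos : (0 : ℝ) < N := by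
    have : 0 < N := by omega
    exact_mod_cast this
  have hpow : (0 : ℝ) < (N : ℝ) ^ n := by positivity
  have hcardle : (Fintype.card (ι ↪ Fin N) : ℝ) ≤ (N : ℝ) ^ n := by
    have : Fintype.card (ι ↪ Fin N) ≤ N ^ n := by
      rw [Fintype.card_embedding_eq, Fintype.card_fin]
      exact Nat.descFactorial_le_pow _ _
    exact_mod_cast this
  have hval : ∀ i : ι ↪ Fin N, Function.Injective fun a => (i a : ℕ) := fun i =>
    Fin.val_injective.comp i.injective
  have hA : |∑ i : ι ↪ Fin N, (f (fun a => i a) (fun a b => Z ω (i a) (i b)) -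
      fK K (fun a => i a) (fun a b => Z ω (i a) (i b)))| ≤ 1 / (k + 1) * (N : ℝ) ^ n := by
    refine le_trans ?_ (mul_le_mul_of_nonneg_left hcardle (by positivity))
    refine (Finset.abs_sum_le_sum_abs _ _).trans ?_
    rw [← ENNReal.ofReal_le_ofReal_iff (by positivity),
      ENNReal.ofReal_mul (by positivity), ENNReal.ofReal_natCast,
      ENNReal.ofReal_sum_of_nonneg fun i _ => abs_nonneg _]
    exact (Finset.sum_le_sum fun i _ => hdiff K _ _).trans h3
  have hB : |∑ i : ι ↪ Fin N, ((∫ ω', fK K (fun a => i a) (fun a b => Z ω' (i a) (i b)) ∂P) - m)| ≤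
      1 / (k + 1) * (N : ℝ) ^ n := by
    refine le_trans ?_ (mul_le_mul_of_nonneg_left hcardle (by positivity))
    refine (Finset.abs_sum_le_sum_abs _ _).trans ?_
    calc _ ≤ ∑ _i : ι ↪ Fin N, (1 / (k + 1) : ℝ) :=
          Finset.sum_le_sum fun i _ => (hmean K _ (hval i) hεfin).trans hεK
      _ = _ := by
        rw [Finset.sum_const, nsmul_eq_mul, Finset.card_univ]
        ring
  have hA' := (div_le_iff₀ hpow).2 hA
  have hB' := (div_le_iff₀ hpow).2 hB
  rw [← abs_of_pos hpow, ← abs_div] at hA' hB'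
  rw [Real.dist_eq, sub_zero] at h1
  rw [Real.dist_eq, mul_one] at h2
  rw [Real.dist_eq]
  -- Four errors, each below `η / 4`: the discarded tail, the fluctuation of the truncated kernel,
  -- the bias of its mean, and the discrepancy between the number of injective tuples and `N ^ n`.
  have hsplit : (∑ i : ι ↪ Fin N, f (fun a => i a) (fun a b => Z ω (i a) (i b))) / (N : ℝ) ^ n - m =
      (∑ i : ι ↪ Fin N, (f (fun a => i a) (fun a b => Z ω (i a) (i b)) -
        fK K (fun a => i a) (fun a b => Z ω (i a) (i b)))) / (N : ℝ) ^ n +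
      (∑ i : ι ↪ Fin N, (fK K (fun a => i a) (fun a b => Z ω (i a) (i b)) -
        ∫ ω', fK K (fun a => i a) (fun a b => Z ω' (i a) (i b)) ∂P)) / (N : ℝ) ^ n +
      (∑ i : ι ↪ Fin N,
        ((∫ ω', fK K (fun a => i a) (fun a b => Z ω' (i a) (i b)) ∂P) - m)) / (N : ℝ) ^ n +
      (m * (Fintype.card (ι ↪ Fin N) / (N : ℝ) ^ n) - m) := by
    simp only [Finset.sum_sub_distrib, Finset.sum_const, Finset.card_univ, nsmul_eq_mul]
    ring
  rw [hsplit]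
  rw [abs_lt] at h1 h2 ⊢
  rw [abs_le] at hA' hB'
  constructor <;> linarith [hA'.1, hA'.2, hB'.1, hB'.2, h1.1, h1.2, h2.1, h2.2]

/-- The strong law of large numbers for averages, over tuples of distinct vertices, of a product of
functions of the entries of a symmetric i.i.d. array along the edges of a simple graph on the
positions. The functions may depend on the relative order of the two vertices. -/
theorem ae_tendsto_edge_product_average [IsProbabilityMeasure P] (hX : ∀ p, Measurable (X p))
    (hind : iIndepFun X P) (hid : ∀ p p', IdentDistrib (X p) (X p') P P)
    {R : Finset (ι × ι)} (hR : ∀ r ∈ R, r.1 ≠ r.2 ∧ r.swap ∉ R)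
    {g : ι × ι → Bool → ℝ → ℝ} (hg : ∀ r s, Measurable (g r s))
    {G : ℝ → ℝ} (hG : Measurable G) (hgG : ∀ r s x, |g r s x| ≤ G x)
    (hGint : ∀ p, Integrable (fun ω => G (X p ω)) P)
    {m : ι × ι → ℝ} (hm : ∀ r ∈ R, ∀ s p, ∫ ω, g r s (X p ω) ∂P = m r) :
    ∀ᵐ ω ∂P, Tendsto (fun N : ℕ => (∑ i : ι ↪ Fin N, ∏ r ∈ R,
      g r (decide (i r.1 < i r.2)) (symmExtend (fun p => X p ω) (i r.1) (i r.2))) /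
        (N : ℝ) ^ Fintype.card ι) atTop (𝓝 (∏ r ∈ R, m r)) := by
  classical
  -- Distinct edges read distinct variables because the labelling is injective and `R` holds each
  -- edge in one orientation only. Means of products therefore become products of means.
  have hedge : ∀ i : ι → ℕ, Function.Injective i → ∃ E : R → IncPair, Function.Injective E ∧
      ∀ (r : R) (x : IncPair → ℝ), symmExtend x (i r.1.1) (i r.1.2) = x (E r) := by
    intro i hi
    refine ⟨fun r => incPair (i r.1.1) (i r.1.2) (hi.ne (hR r.1 r.2).1), ?_, fun r x =>
      symmExtend_eq _ _⟩
    rintro ⟨⟨a, b⟩, hr⟩ ⟨⟨a', b'⟩, hr'⟩ h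
    rw [incPair_eq_iff, hi.eq_iff, hi.eq_iff, hi.eq_iff, hi.eq_iff] at h
    rcases h with ⟨h1, h2⟩ | ⟨h1, h2⟩
    · simp only at h1 h2
      subst h1 h2
      rfl
    · simp only at h1 h2
      subst h1 h2
      exact absurd hr' (hR _ hr).2
  have hG0 : ∀ r : ι × ι, ∀ x, 0 ≤ G x := fun r x => (abs_nonneg _).trans (hgG r true x)
  refine ae_tendsto_kernel_average hX hind hid
    (f := fun i x => ∏ r ∈ R, g r (decide (i r.1 < i r.2)) (x r.1 r.2))
    (D := fun x => ∏ r ∈ R, G (x r.1 r.2)) (fun i => ?_) ?_ (fun i x => ?_) (fun i hi => ?_)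
    (fun i hi => ?_)
  · exact Finset.measurable_fun_prod _ fun r _ => (hg r _).comp (by fun_prop)
  · exact Finset.measurable_fun_prod _ fun r _ => hG.comp (by fun_prop)
  · rw [Finset.abs_prod]
    exact Finset.prod_le_prod (fun r _ => abs_nonneg _) fun r _ => hgG _ _ _
  · obtain ⟨E, hE, hE'⟩ := hedge i hi
    have h1 : ∀ ω, ∏ r ∈ R, G (symmExtend (fun p => X p ω) (i r.1) (i r.2)) =
        ∏ r : R, G (X (E r) ω) := by
      intro ω
      rw [← Finset.prod_coe_sort R]
      exact Finset.prod_congr rfl fun r _ => by rw [hE']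
    simp only [h1]
    have hI : iIndepFun (fun r : R => fun ω => G (X (E r) ω)) P :=
      (hind.precomp hE).comp (fun _ => G) fun _ => hG
    have hI' : iIndepFun (fun r : R => fun ω => ENNReal.ofReal (G (X (E r) ω))) P :=
      (hind.precomp hE).comp (fun _ x => ENNReal.ofReal (G x)) fun _ => hG.ennreal_ofReal
    refine ⟨(Finset.measurable_fun_prod _ fun r _ =>
      hG.comp (hX (E r))).aestronglyMeasurable, ?_⟩
    -- Independence factors the integral of the product envelope, so integrability of each single `G
    -- (X p)` suffices.
    rw [hasFiniteIntegral_iff_ofReal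
      (ae_of_all _ fun ω => Finset.prod_nonneg fun r _ => hG0 r.1 _)]
    simp only [ENNReal.ofReal_prod_of_nonneg fun (r : R) _ => hG0 r.1 _]
    rw [lintegral_prod_eq_prod_lintegral_of_indepFun _ _ hI'
      fun r => (hG.comp (hX (E r))).ennreal_ofReal]
    exact ENNReal.prod_lt_top fun r _ => (hGint (E r)).lintegral_lt_top
  · obtain ⟨E, hE, hE'⟩ := hedge i hi
    have h1 : ∀ ω, ∏ r ∈ R, g r (decide (i r.1 < i r.2))
        (symmExtend (fun p => X p ω) (i r.1) (i r.2)) =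
        ∏ r : R, g r.1 (decide (i r.1.1 < i r.1.2)) (X (E r) ω) := by
      intro ω
      rw [← Finset.prod_coe_sort R]
      exact Finset.prod_congr rfl fun r _ => by rw [hE']
    simp only [h1]
    have hI : iIndepFun
        (fun r : R => fun ω => g r.1 (decide (i r.1.1 < i r.1.2)) (X (E r) ω)) P :=
      (hind.precomp hE).comp (fun r => g r.1 (decide (i r.1.1 < i r.1.2))) fun r => hg _ _
    rw [hI.integral_fun_prod_eq_prod_integral
      fun r => ((hg _ _).comp (hX (E r))).aestronglyMeasurable, ← Finset.prod_coe_sort R]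
    exact Finset.prod_congr rfl fun r _ => hm r.1 r.2 _ _

end IID

end NCCLT

namespace NCCLT

/-! ### Reordering words and factoring their moments. -/

section Words

variable {A : Type*} [Ring A] [StarRing A] [Algebra ℂ A]

/-- The product of the letters with index `v` in the word `b_{j 0}^{ε 0} ⋯ b_{j (m-1)}^{ε (m-1)}`,
in their order of appearance. -/
def subword (b : ℕ → A) {m : ℕ} (j : Fin m → ℕ) (ε : Fin m → Expo) (v : ℕ) : A :=
  (List.ofFn fun k => if j k = v then epow (b v) (ε k) else 1).prod

/-- The scalar produced when a word is put into natural order by commutations with the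
coefficients `c`: a product over the inversions of `j`. -/
def wordWeight (c : Expo → Expo → ℕ → ℕ → ℝ) {m : ℕ} (j : Fin m → ℕ) (ε : Fin m → Expo) : ℝ :=
  ∏ k, ∏ l, if k < l ∧ j l < j k then c (ε l) (ε k) (j l) (j k) else 1

theorem wordWeight_succ (c : Expo → Expo → ℕ → ℕ → ℝ) {m : ℕ} (j : Fin (m + 1) → ℕ)
    (ε : Fin (m + 1) → Expo) :
    wordWeight c j ε =
      (∏ l : Fin m, if j l.succ < j 0 then c (ε l.succ) (ε 0) (j l.succ) (j 0) else 1) *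
        wordWeight c (fun k => j k.succ) fun k => ε k.succ := by
  simp [wordWeight, Fin.prod_univ_succ]

omit [Algebra ℂ A] in
theorem subword_succ (b : ℕ → A) {m : ℕ} (j : Fin (m + 1) → ℕ) (ε : Fin (m + 1) → Expo) (v : ℕ) :
    subword b j ε v = (if j 0 = v then epow (b v) (ε 0) else 1) *
      subword b (fun k => j k.succ) (fun k => ε k.succ) v := by
  simp [subword, List.ofFn_succ]

section Commutation

variable {c : Expo → Expo → ℕ → ℕ → ℝ} {b : ℕ → A} (hc : CommutationRelation c b)
include hc

theorem epow_mul_subword {m : ℕ} (j : Fin m → ℕ) (ε : Fin m → Expo) {i v : ℕ} (h : i ≠ v)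
    (e : Expo) :
    epow (b i) e * subword b j ε v =
      ((∏ l, if j l = v then c (ε l) e (j l) i else 1 : ℝ) : ℂ) •
        (subword b j ε v * epow (b i) e) := by
  induction m with
  | zero => simp [subword]
  | succ m ih =>
    rw [subword_succ, Fin.prod_univ_succ]
    have ih' := ih (fun k => j k.succ) fun k => ε k.succ
    by_cases h0 : j 0 = v
    · rw [if_pos h0, if_pos h0, ← mul_assoc, hc i v h e (ε 0), smul_mul_assoc, mul_assoc, ih', h0,
        mul_smul_comm, smul_smul, mul_assoc, Complex.ofReal_mul]
    · rw [if_neg h0, if_neg h0, one_mul, one_mul, ih']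

/-- Since `M ≤ i`, the letter moves to the right past blocks of smaller index only, paying one
coefficient per letter passed. -/
theorem epow_mul_prod_subword {m : ℕ} (j : Fin m → ℕ) (ε : Fin m → Expo) {i M : ℕ} (h : M ≤ i)
    (e : Expo) :
    epow (b i) e * ((List.range M).map (subword b j ε)).prod =
      ((∏ l, if j l < M then c (ε l) e (j l) i else 1 : ℝ) : ℂ) •
        (((List.range M).map (subword b j ε)).prod * epow (b i) e) := by
  induction M with
  | zero => simp
  | succ M ih =>
    have hsplit : (∏ l, if j l < M + 1 then c (ε l) e (j l) i else 1 : ℝ) =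
        (∏ l, if j l < M then c (ε l) e (j l) i else 1) *
          ∏ l, if j l = M then c (ε l) e (j l) i else 1 := by
      rw [← Finset.prod_mul_distrib]
      refine Finset.prod_congr rfl fun l _ => ?_
      rcases lt_trichotomy (j l) M with h' | h' | h'
      · simp [h', h'.ne, Nat.lt_succ_of_lt h']
      · simp [h']
      · simp [h'.not_gt, h'.ne', show ¬ j l < M + 1 by omega]
    rw [List.range_succ, List.map_append, List.prod_append, List.map_singleton, List.prod_singleton,
      ← mul_assoc, ih (by omega), smul_mul_assoc, mul_assoc,
      epow_mul_subword hc j ε (by omega) e, mul_smul_comm, smul_smul, mul_assoc, hsplit,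
      Complex.ofReal_mul]

/-- Every word is a multiple of the naturally ordered product of its subwords. -/
theorem word_eq_smul {m : ℕ} (j : Fin m → ℕ) (ε : Fin m → Expo) {N : ℕ} (hj : ∀ k, j k < N) :
    (List.ofFn fun k => epow (b (j k)) (ε k)).prod =
      (wordWeight c j ε : ℂ) • ((List.range N).map (subword b j ε)).prod := by
  induction m with
  | zero => simp [wordWeight, show subword b j ε = fun _ => 1 from funext fun v => by simp [subword]]
  | succ m ih =>
    have ih' := ih (fun k => j k.succ) (fun k => ε k.succ) fun k => hj k.succ
    rw [List.ofFn_succ, List.prod_cons, ih', wordWeight_succ, mul_smul_comm, Complex.ofReal_mul,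
      mul_comm, mul_smul]
    congr 1
    set S := subword b j ε
    set S' := subword b (fun k => j k.succ) fun k => ε k.succ
    have hS0 : S (j 0) = epow (b (j 0)) (ε 0) * S' (j 0) := by
      simp [S, S', subword_succ]
    have hSne : ∀ v, v ≠ j 0 → S v = S' v := by
      intro v hv
      simp [S, S', subword_succ, hv.symm]
    have hlt : j 0 + 1 ≤ N := hj 0
    clear hj ih ih'
    -- In the base case the new first letter passes all blocks of smaller index and joins its own
    -- block on the left. Blocks of larger index are untouched, which is the inductive step.
    induction N, hlt using Nat.le_induction with
    | base =>
      have hmap : (List.range (j 0)).map S = (List.range (j 0)).map S' :=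
        List.map_congr_left fun v hv => hSne v (List.mem_range.1 hv).ne
      rw [List.range_succ, List.map_append, List.prod_append, List.map_append, List.prod_append,
        List.map_singleton, List.prod_singleton, List.map_singleton, List.prod_singleton,
        ← mul_assoc, epow_mul_prod_subword hc _ _ le_rfl, smul_mul_assoc, mul_assoc, hS0, hmap]
    | succ N hN ih =>
      rw [List.range_succ, List.map_append, List.prod_append, List.map_append, List.prod_append,
        List.map_singleton, List.prod_singleton, List.map_singleton, List.prod_singleton,
        ← mul_assoc, ih, smul_mul_assoc, hSne N (by omega)]

end Commutation

theorem prod_map_ite_one {M α : Type*} [Monoid M] (p : α → Prop) [DecidablePred p] (f : α → M)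
    (l : List α) :
    (l.map fun a => if p a then f a else 1).prod = ((l.filter p).map f).prod := by
  induction l with
  | nil => simp
  | cons a l ih =>
    by_cases h : p a
    · simp [h, ih]
    · simp [h, ih]

theorem prod_map_filter_of_eq_one {M α : Type*} [Monoid M] {p : α → Prop} [DecidablePred p]
    (f : α → M) (hf : ∀ a, ¬ p a → f a = 1) (l : List α) :
    ((l.filter p).map f).prod = (l.map f).prod := by
  rw [← prod_map_ite_one]
  congr 1
  refine List.map_congr_left fun a _ => ?_
  by_cases h : p a
  · rw [if_pos h]
  · rw [if_neg h, hf a h]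

omit [Algebra ℂ A] in
theorem subword_eq_filter (b : ℕ → A) {m : ℕ} (j : Fin m → ℕ) (ε : Fin m → Expo) (v : ℕ) :
    subword b j ε v =
      (((List.finRange m).filter fun k => j k = v).map fun k => epow (b v) (ε k)).prod := by
  rw [subword, List.ofFn_eq_map, prod_map_ite_one]

theorem finRange_filter_eq_pair {m : ℕ} {p q : Fin m} (h : p < q) (P : Fin m → Prop)
    [DecidablePred P] (hP : ∀ k, P k ↔ k = p ∨ k = q) :
    (List.finRange m).filter P = [p, q] := by
  refine List.Perm.eq_of_pairwise (le := (· < ·)) (fun a b _ _ h1 h2 => absurd h1 h2.asymm) ?_ ?_ ?_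
  · exact (List.pairwise_lt_finRange m).filter _
  · simpa using h
  · rw [List.perm_ext_iff_of_nodup ((List.nodup_finRange m).filter _) (by simpa using h.ne)]
    intro k
    simp [hP]

theorem finRange_filter_eq_singleton {m : ℕ} {p : Fin m} (P : Fin m → Prop)
    [DecidablePred P] (hP : ∀ k, P k ↔ k = p) :
    (List.finRange m).filter P = [p] := by
  rw [← List.perm_singleton]
  rw [List.perm_ext_iff_of_nodup ((List.nodup_finRange m).filter _) (by simp)]
  intro k
  simp [hP]

variable {φ : A →ₗ[ℂ] ℂ} {b : ℕ → A}

/-- The factorization hypothesis admits nonempty blocks only. Indices that do not occur give empty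
subwords, equal to `1`, which can be discarded on both sides because `φ 1 = 1`. -/
theorem map_prod_subword (h1 : φ 1 = 1) (hf : FactorsOverNaturallyOrdered φ b) {m : ℕ}
    (j : Fin m → ℕ) (ε : Fin m → Expo) (N : ℕ) :
    φ ((List.range N).map (subword b j ε)).prod =
      ∏ v ∈ Finset.range N, φ (subword b j ε v) := by
  let F : ℕ × List Expo → A := fun B => (B.2.map (epow (b B.1))).prod
  let blk : ℕ → ℕ × List Expo := fun v => (v, ((List.finRange m).filter fun k => j k = v).map ε)
  have hblk : ∀ v, F (blk v) = subword b j ε v := by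
    intro v
    simp [F, blk, subword_eq_filter, Function.comp_def]
  have key := hf (((List.range N).map blk).filter fun B => B.2 ≠ [])
    (fun B hB => by simpa using (List.mem_filter.1 hB).2) ?_
  · change φ (List.map F _).prod = (List.map (fun B => φ (F B)) _).prod at key
    rw [prod_map_filter_of_eq_one F fun B hB => by simp [F, not_not.1 hB],
      prod_map_filter_of_eq_one (fun B => φ (F B)) fun B hB => by simp [F, not_not.1 hB, h1]] at key
    simp only [List.map_map, Function.comp_def, hblk] at key
    rw [key, ← List.prod_toFinset _ List.nodup_range, List.toFinset_range]
  · have hs : ((((List.range N).map blk).filter fun B => B.2 ≠ []).map Prod.fst).Sublist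
        (List.range N) := by
      have := (List.filter_sublist (p := fun B => B.2 ≠ [])
        (l := (List.range N).map blk)).map Prod.fst
      simpa [Function.comp_def, blk] using this
    exact List.pairwise_lt_range.sublist hs

variable {c : Expo → Expo → ℕ → ℕ → ℝ}

/-- The moment of a word is its weight times the product of the moments of its subwords. -/
theorem map_word (h1 : φ 1 = 1) (hf : FactorsOverNaturallyOrdered φ b)
    (hc : CommutationRelation c b) {m : ℕ} (j : Fin m → ℕ) (ε : Fin m → Expo) {N : ℕ}
    (hj : ∀ k, j k < N) :
    φ (List.ofFn fun k => epow (b (j k)) (ε k)).prod =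
      wordWeight c j ε * ∏ v ∈ Finset.range N, φ (subword b j ε v) := by
  rw [word_eq_smul hc j ε hj, map_smul, map_prod_subword h1 hf, smul_eq_mul]

/-- The subword of that index is a single letter, which is centred. -/
theorem map_word_eq_zero_of_unique_index (h1 : φ 1 = 1) (hb : MomentCondition φ b)
    (hc : CommutationRelation c b) {m : ℕ} (j : Fin m → ℕ) (ε : Fin m → Expo) {N : ℕ}
    (hj : ∀ k, j k < N) {k₀ : Fin m} (hk₀ : ∀ k, j k = j k₀ → k = k₀) :
    φ (List.ofFn fun k => epow (b (j k)) (ε k)).prod = 0 := by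
  rw [map_word h1 hb.factors hc j ε hj,
    Finset.prod_eq_zero (Finset.mem_range.2 (hj k₀)) _, mul_zero]
  rw [subword_eq_filter, finRange_filter_eq_singleton (p := k₀) _
    fun k => ⟨hk₀ k, fun h => by rw [h]⟩]
  cases h : ε k₀
  · simpa [h, epow] using hb.centred _
  · simpa [h, epow] using hb.centred_star _

end Words

end NCCLT

namespace NCCLT

/-! ### Pair partitions, their blocks and index tuples that form pairings. -/

section PairPartitions

variable {m : ℕ} {V : Finset (Fin m × Fin m)}

theorem fst_lt_snd_of_mem (hV : V ∈ pairPartitions m) {p : Fin m × Fin m} (hp : p ∈ V) :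
    p.1 < p.2 :=
  (Finset.mem_filter.1 hV).2.1 p hp

theorem exists_unique_block (hV : V ∈ pairPartitions m) (k : Fin m) :
    ∃ p : V, ∀ q ∈ V, (q.1 = k ∨ q.2 = k) ↔ q = p := by
  obtain ⟨p, hp⟩ := Finset.card_eq_one.1 ((Finset.mem_filter.1 hV).2.2 k)
  have hmem : ∀ q, (q ∈ V ∧ (q.1 = k ∨ q.2 = k)) ↔ q = p := by
    intro q
    simpa using Finset.ext_iff.1 hp q
  refine ⟨⟨p, ((hmem p).2 rfl).1⟩, fun q hq => ?_⟩
  rw [← hmem]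
  simp [hq]

/-- The block of a pair partition that contains `k`. -/
noncomputable def blockOf (hV : V ∈ pairPartitions m) (k : Fin m) : V :=
  (exists_unique_block hV k).choose

theorem blockOf_eq_iff (hV : V ∈ pairPartitions m) (k : Fin m) (p : V) :
    blockOf hV k = p ↔ k = p.1.1 ∨ k = p.1.2 := by
  have := (exists_unique_block hV k).choose_spec p.1 p.2
  rw [eq_comm (a := k), eq_comm (a := k), this, ← Subtype.ext_iff, eq_comm]
  rfl

theorem blockOf_fst (hV : V ∈ pairPartitions m) (p : V) : blockOf hV p.1.1 = p :=
  (blockOf_eq_iff hV _ _).2 (Or.inl rfl)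

theorem blockOf_snd (hV : V ∈ pairPartitions m) (p : V) : blockOf hV p.1.2 = p :=
  (blockOf_eq_iff hV _ _).2 (Or.inr rfl)

theorem filter_blockOf_eq (hV : V ∈ pairPartitions m) (p : V) :
    (Finset.univ.filter fun k => blockOf hV k = p) = {p.1.1, p.1.2} := by
  ext k
  simp [blockOf_eq_iff]

theorem prod_eq_prod_blocks {M : Type*} [CommMonoid M] (hV : V ∈ pairPartitions m)
    (G : Fin m → M) : ∏ k, G k = ∏ p : V, G p.1.1 * G p.1.2 := by
  rw [← Finset.prod_fiberwise (g := blockOf hV)]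
  refine Finset.prod_congr rfl fun p _ => ?_
  rw [filter_blockOf_eq, Finset.prod_pair (fst_lt_snd_of_mem hV p.2).ne]

theorem two_mul_card_of_mem_pairPartitions (hV : V ∈ pairPartitions m) : 2 * V.card = m := by
  have h := Finset.card_eq_sum_card_fiberwise (f := blockOf hV) (s := Finset.univ)
    (t := Finset.univ) fun _ _ => Finset.mem_coe.2 (Finset.mem_univ _)
  simp only [filter_blockOf_eq] at h
  rw [Finset.sum_congr rfl fun p _ => Finset.card_pair (fst_lt_snd_of_mem hV p.2).ne] at h
  simp at h
  omega

theorem block_eq_of_fst_eq (hV : V ∈ pairPartitions m) {p q : V} (h : p.1.1 = q.1.1) : p = q := by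
  rw [← blockOf_fst hV p, h, blockOf_fst]

theorem block_eq_of_snd_eq (hV : V ∈ pairPartitions m) {p q : V} (h : p.1.2 = q.1.2) : p = q := by
  rw [← blockOf_snd hV p, h, blockOf_snd]

theorem fst_ne_snd_of_mem (hV : V ∈ pairPartitions m) (p q : V) : p.1.1 ≠ q.1.2 := by
  intro h
  have h1 : p = q := by rw [← blockOf_fst hV p, h, blockOf_snd]
  subst h1
  exact (fst_lt_snd_of_mem hV p.2).ne h

/-- The pairs of blocks listed in the order of their first elements. -/
def orderedBlockPairs (V : Finset (Fin m × Fin m)) : Finset (V × V) :=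
  Finset.univ.filter fun r => r.1.1.1 < r.2.1.1

/-- Distinct blocks have distinct first elements, so each unordered pair of blocks is met once in
each order. -/
theorem prod_block_pairs {M : Type*} [CommMonoid M] (hV : V ∈ pairPartitions m)
    (a : V × V → M) (hdiag : ∀ p, a (p, p) = 1) :
    ∏ r, a r = ∏ r ∈ orderedBlockPairs V, a r * a r.swap := by
  rw [Finset.prod_mul_distrib, ← Finset.prod_filter_mul_prod_filter_not Finset.univ
    (fun r : V × V => r.1.1.1 < r.2.1.1)]
  congr 1
  rw [← Finset.prod_filter_mul_prod_filter_not _ (fun r : V × V => r.2.1.1 < r.1.1.1)]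
  have h2 : ∏ r ∈ (Finset.univ.filter fun r : V × V => ¬ r.1.1.1 < r.2.1.1).filter
      (fun r => ¬ r.2.1.1 < r.1.1.1), a r = 1 := by
    refine Finset.prod_eq_one fun r hr => ?_
    simp only [Finset.mem_filter, Finset.mem_univ, true_and] at hr
    have : r.1 = r.2 := block_eq_of_fst_eq hV (le_antisymm (not_lt.1 hr.2) (not_lt.1 hr.1))
    obtain ⟨p, q⟩ := r
    simp only at this
    subst this
    exact hdiag p
  rw [h2, mul_one]
  refine Finset.prod_equiv (Equiv.prodComm _ _) (fun r => ?_) fun r _ => by simp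
  simp only [orderedBlockPairs, Finset.mem_filter, Finset.mem_univ, true_and, Equiv.prodComm_apply,
    Prod.fst_swap, Prod.snd_swap]
  exact ⟨fun h => h.2, fun h => ⟨h.not_gt, h⟩⟩

/-- The two blocks cross, with the first one opening first. -/
def Crosses (r : V × V) : Prop :=
  r.1.1.1 < r.2.1.1 ∧ r.2.1.1 < r.1.1.2 ∧ r.1.1.2 < r.2.1.2

/-- The second block is nested in the first one. -/
def Nests (r : V × V) : Prop :=
  r.1.1.1 < r.2.1.1 ∧ r.2.1.1 < r.2.1.2 ∧ r.2.1.2 < r.1.1.2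

instance : DecidablePred (Crosses (V := V)) := fun _ => inferInstanceAs (Decidable (_ ∧ _))

instance : DecidablePred (Nests (V := V)) := fun _ => inferInstanceAs (Decidable (_ ∧ _))

theorem Crosses.not_nests {r : V × V} (h : Crosses r) : ¬ Nests r := fun h' =>
  (h.2.2.trans h'.2.2).false

theorem card_filter_attach_product (s : Finset (Fin m × Fin m))
    (p : (Fin m × Fin m) × (Fin m × Fin m) → Prop) [DecidablePred p] :
    ((s ×ˢ s).filter p).card =
      (Finset.univ.filter fun r : s × s => p (r.1.1, r.2.1)).card := by
  refine (Finset.card_bij (fun r _ => (r.1.1, r.2.1)) ?_ ?_ ?_).symm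
  · rintro ⟨a, b⟩ h
    simpa using h
  · rintro ⟨a, b⟩ - ⟨a', b'⟩ - h
    simp only [Prod.mk.injEq, Subtype.val_inj] at h
    exact Prod.ext h.1 h.2
  · rintro ⟨a, b⟩ h
    simp only [Finset.mem_filter, Finset.mem_product] at h
    exact ⟨(⟨a, h.1.1⟩, ⟨b, h.1.2⟩), by simpa using h.2, rfl⟩

/-- The powers of `q` and `t` counting crossings and nestings, as a product over pairs of
blocks. -/
theorem prod_orderedBlockPairs_eq (V : Finset (Fin m × Fin m)) (q t : ℝ) :
    ∏ r ∈ orderedBlockPairs V, (if Crosses r then q else if Nests r then t else 1) =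
      q ^ crossings V * t ^ nestings V := by
  have h1 : crossings V = (Finset.univ.filter fun r : V × V => Crosses r).card :=
    card_filter_attach_product V _
  have h2 : nestings V = (Finset.univ.filter fun r : V × V => Nests r).card :=
    card_filter_attach_product V _
  rw [h1, h2, ← Finset.prod_const, ← Finset.prod_const, Finset.prod_filter, Finset.prod_filter,
    ← Finset.prod_mul_distrib, orderedBlockPairs, Finset.prod_filter]
  refine Finset.prod_congr rfl fun r _ => ?_
  by_cases hc : Crosses r
  · simp [hc, hc.not_nests, hc.1]
  · by_cases hn : Nests r
    · simp [hc, hn, hn.1]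
    · simp [hc, hn]

/-- Every index that occurs in `j` occurs exactly twice. -/
def IsPairing {α : Type*} (j : Fin m → α) : Prop :=
  ∀ k, ∃ k', k' ≠ k ∧ ∀ l, j l = j k ↔ l = k ∨ l = k'

/-- The pairs of positions that carry the same index. -/
def kernelPairs {α : Type*} [DecidableEq α] (j : Fin m → α) : Finset (Fin m × Fin m) :=
  Finset.univ.filter fun p => p.1 < p.2 ∧ j p.1 = j p.2

theorem kernelPairs_mem_pairPartitions {α : Type*} [DecidableEq α] {j : Fin m → α}
    (hj : IsPairing j) : kernelPairs j ∈ pairPartitions m := by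
  refine Finset.mem_filter.2 ⟨Finset.mem_univ _, fun p hp => (Finset.mem_filter.1 hp).2.1,
    fun k => ?_⟩
  obtain ⟨k', hne, hk'⟩ := hj k
  rw [Finset.card_eq_one]
  refine ⟨(min k k', max k k'), ?_⟩
  have hkk : j k' = j k := (hk' k').2 (Or.inr rfl)
  ext ⟨x, y⟩
  simp only [kernelPairs, Finset.mem_filter, Finset.mem_univ, true_and, Finset.mem_singleton,
    Prod.mk.injEq]
  constructor
  · rintro ⟨⟨hlt, he⟩, rfl | rfl⟩
    · have := ((hk' y).1 he.symm).resolve_left hlt.ne'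
      subst this
      simp [hlt.le]
    · have := ((hk' x).1 he).resolve_left hlt.ne
      subst this
      simp [hlt.le]
  · rcases lt_or_gt_of_ne hne with h | h
    · rw [min_eq_right h.le, max_eq_left h.le]
      rintro ⟨rfl, rfl⟩
      exact ⟨⟨h, hkk⟩, Or.inr rfl⟩
    · rw [min_eq_left h.le, max_eq_right h.le]
      rintro ⟨rfl, rfl⟩
      exact ⟨⟨h, hkk.symm⟩, Or.inl rfl⟩

theorem isPairing_comp_blockOf {α : Type*} (hV : V ∈ pairPartitions m) (i : V ↪ α) :
    IsPairing fun k => i (blockOf hV k) := by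
  intro k
  have h := (blockOf_eq_iff hV k (blockOf hV k)).1 rfl
  have hne := fst_lt_snd_of_mem hV (blockOf hV k).2
  rcases h with h | h
  · refine ⟨(blockOf hV k).1.2, fun e => hne.ne (h.symm.trans e.symm), fun l => ?_⟩
    rw [i.injective.eq_iff, blockOf_eq_iff, ← h]
  · refine ⟨(blockOf hV k).1.1, fun e => hne.ne (e.trans h), fun l => ?_⟩
    rw [i.injective.eq_iff, blockOf_eq_iff, ← h, or_comm]

theorem kernelPairs_comp_blockOf {α : Type*} [DecidableEq α] (hV : V ∈ pairPartitions m)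
    (i : V ↪ α) : kernelPairs (fun k => i (blockOf hV k)) = V := by
  ext ⟨x, y⟩
  simp only [kernelPairs, Finset.mem_filter, Finset.mem_univ, true_and, i.injective.eq_iff]
  constructor
  · rintro ⟨hlt, he⟩
    have hx := (blockOf_eq_iff hV x _).1 rfl
    have hy := (blockOf_eq_iff hV y _).1 he.symm
    have hne := fst_lt_snd_of_mem hV (blockOf hV x).2
    have : (x, y) = (blockOf hV x).1 := by
      rcases hx with hx | hx <;> rcases hy with hy | hy
      · exact absurd (hx.trans hy.symm) hlt.ne
      · exact Prod.ext hx hy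
      · rw [← hx, ← hy] at hne
        exact absurd hne hlt.asymm
      · exact absurd (hx.trans hy.symm) hlt.ne
    rw [this]
    exact (blockOf hV x).2
  · intro h
    exact ⟨fst_lt_snd_of_mem hV h,
      (blockOf_fst hV ⟨(x, y), h⟩).trans (blockOf_snd hV ⟨(x, y), h⟩).symm⟩

/-- Label each block by the value of `j` at its first element. Equal labels on two blocks would make
their first elements a block, but no element both opens and closes a block. -/
theorem exists_embedding_of_kernelPairs_eq {α : Type*} [DecidableEq α]
    (hV : V ∈ pairPartitions m) {j : Fin m → α} (h : kernelPairs j = V) :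
    ∃ i : V ↪ α, (fun k => i (blockOf hV k)) = j := by
  have hmem : ∀ x y, (x, y) ∈ V ↔ x < y ∧ j x = j y := by
    intro x y
    rw [← h]
    simp [kernelPairs]
  have aux : ∀ p q : V, p.1.1 < q.1.1 → j p.1.1 ≠ j q.1.1 := by
    intro p q hlt he
    have h1 := (hmem _ _).2 ⟨hlt, he⟩
    exact fst_ne_snd_of_mem hV q ⟨_, h1⟩ rfl
  refine ⟨⟨fun p => j p.1.1, fun p q he => ?_⟩, ?_⟩
  · rcases lt_trichotomy p.1.1 q.1.1 with hlt | heq | hlt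
    · exact absurd he (aux p q hlt)
    · exact block_eq_of_fst_eq hV heq
    · exact absurd he.symm (aux q p hlt)
  · funext k
    change j (blockOf hV k).1.1 = j k
    rcases (blockOf_eq_iff hV k (blockOf hV k)).1 rfl with h' | h'
    · rw [← h']
    · have h2 := ((hmem (blockOf hV k).1.1 (blockOf hV k).1.2).1 (blockOf hV k).2).2
      rw [h2, ← h']

open Classical in
/-- Summing over the index tuples in which every index occurs exactly twice amounts to summing over
the pair partitions and over the injective labellings of their blocks. -/
theorem sum_isPairing {M α : Type*} [AddCommMonoid M] [Fintype α] [DecidableEq α]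
    (F : (Fin m → α) → M) :
    ∑ j ∈ Finset.univ.filter (fun j : Fin m → α => IsPairing j), F j =
      ∑ V : {V // V ∈ pairPartitions m}, ∑ i : V.1 ↪ α, F fun k => i (blockOf V.2 k) := by
  rw [← Finset.sum_fiberwise_of_maps_to (t := pairPartitions m) (g := kernelPairs)
    fun j hj => kernelPairs_mem_pairPartitions (Finset.mem_filter.1 hj).2,
    ← Finset.sum_coe_sort]
  refine Finset.sum_congr rfl fun V _ => ?_
  refine (Finset.sum_bij (fun (i : V.1 ↪ α) _ => fun k => i (blockOf V.2 k)) ?_ ?_ ?_ ?_).symm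
  · intro i _
    exact Finset.mem_filter.2 ⟨Finset.mem_filter.2 ⟨Finset.mem_univ _,
      isPairing_comp_blockOf V.2 i⟩, kernelPairs_comp_blockOf V.2 i⟩
  · intro i _ i' _ h
    ext p
    have := congrFun h p.1.1
    simpa only [blockOf_fst] using this
  · intro j hj
    obtain ⟨i, hi⟩ := exists_embedding_of_kernelPairs_eq V.2 (Finset.mem_filter.1 hj).2
    exact ⟨i, Finset.mem_univ _, hi⟩
  · intro i _
    rfl

/-- All fibres of `j` have at least two elements while their average size is at most two, so all
have exactly two. -/
theorem isPairing_of_card_image {α : Type*} [DecidableEq α] {j : Fin m → α}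
    (h1 : ∀ k₀, ∃ k, j k = j k₀ ∧ k ≠ k₀) (h2 : m ≤ 2 * (Finset.univ.image j).card) :
    IsPairing j := by
  have hge : ∀ v ∈ Finset.univ.image j, 2 ≤ (Finset.univ.filter fun k => j k = v).card := by
    intro v hv
    obtain ⟨k₀, -, rfl⟩ := Finset.mem_image.1 hv
    obtain ⟨k, hk, hne⟩ := h1 k₀
    exact Finset.one_lt_card.2 ⟨k, by simp [hk], k₀, by simp, hne⟩
  have hsum : m = ∑ v ∈ Finset.univ.image j, (Finset.univ.filter fun k => j k = v).card := by
    have := Finset.card_eq_sum_card_image j Finset.univ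
    simpa using this
  have hle : ∑ v ∈ Finset.univ.image j, 2 =
      ∑ v ∈ Finset.univ.image j, (Finset.univ.filter fun k => j k = v).card := by
    refine le_antisymm (Finset.sum_le_sum hge) ?_
    rw [← hsum, Finset.sum_const, smul_eq_mul, mul_comm]
    exact h2
  have heq := (Finset.sum_eq_sum_iff_of_le hge).1 hle
  intro k
  obtain ⟨k', hk', hne⟩ := h1 k
  refine ⟨k', hne, fun l => ⟨fun hl => ?_, ?_⟩⟩
  · by_contra! hcon
    have hcard := heq (j k) (Finset.mem_image_of_mem j (Finset.mem_univ k))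
    have h3 : 2 < (Finset.univ.filter fun x => j x = j k).card :=
      Finset.two_lt_card.2 ⟨l, by simp [hl], k, by simp, k', by simp [hk'], hcon.1, hcon.2,
        hne.symm⟩
    omega
  · rintro (rfl | rfl)
    · rfl
    · exact hk'

/-- A tuple with at most `r` values factors through `Fin r`. The assumption `m ≠ 0` supplies a value
for the unused elements of `Fin r`. -/
theorem card_filter_card_image_le (m N r : ℕ) (hm : m ≠ 0) :
    (Finset.univ.filter fun j : Fin m → Fin N => (Finset.univ.image j).card ≤ r).card ≤
      r ^ m * N ^ r := by
  have hsub : (Finset.univ.filter fun j : Fin m → Fin N => (Finset.univ.image j).card ≤ r) ⊆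
      Finset.univ.image fun x : (Fin m → Fin r) × (Fin r → Fin N) => x.2 ∘ x.1 := by
    intro j hj
    have hr := (Finset.mem_filter.1 hj).2
    let v₀ : Fin N := j ⟨0, Nat.pos_of_ne_zero hm⟩
    let e := (Finset.univ.image j).equivFin
    refine Finset.mem_image.2 ⟨(fun k => Fin.castLE hr (e ⟨j k, by simp⟩),
      fun x => if h : x < (Finset.univ.image j).card then e.symm ⟨x, h⟩ else v₀),
      Finset.mem_univ _, ?_⟩
    funext k
    simp
  refine (Finset.card_le_card hsub).trans (Finset.card_image_le.trans (le_of_eq ?_))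
  simp

end PairPartitions

end NCCLT

namespace NCCLT

/-! ### Weights of pairings and the limit of the moments. -/

section PairingMoments

variable {m : ℕ} {V : Finset (Fin m × Fin m)}

/-- The contribution of two blocks to the weight of a pairing, in terms of the coefficient `y`
attached to their indices; the flag tells whether the index of the first block is the smaller
one. -/
noncomputable def blockPairFactor (t : ℝ) (r : V × V) (s : Bool) (y : ℝ) : ℝ :=
  if Crosses r then t * y else if Nests r then (if s then t * y ^ 2 else t) else 1

/-- Group the inversions by pairs of blocks `w < z`, `w' < z'` with `w < w'`, and let `y` be the
coefficient of their labels. If the first label is smaller, the inversions are `(w', z)` for a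
crossing, giving `t * y`, and `(w', z)`, `(z', z)` for a nesting, giving `t * y ^ 2`. If it is
larger, a crossing gives `(1 / y) * (t * y) * y` and a nesting `(1 / y) * (t * y)`. Disjoint blocks
have either no inversion or all four, whose coefficients multiply to `1`. -/
theorem wordWeight_pairing (hV : V ∈ pairPartitions m) {i : V → ℕ} (hi : Function.Injective i)
    {ε : Fin m → Expo} (hε : ∀ p ∈ V, ε p.1 = Expo.one ∧ ε p.2 = Expo.adj) {t : ℝ} (ht : t ≠ 0)
    {μ z : ℕ → ℕ → ℝ} (hμ : ∀ a b, a < b → μ a b ≠ 0)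
    (hz : ∀ a b, a < b → z a b = μ a b ∧ z b a = μ a b) :
    wordWeight (commCoeff t μ) (fun k => i (blockOf hV k)) ε =
      ∏ r ∈ orderedBlockPairs V,
        blockPairFactor t r (decide (i r.1 < i r.2)) (z (i r.1) (i r.2)) := by
  let T (k l : Fin m) : ℝ := if k < l ∧ i (blockOf hV l) < i (blockOf hV k) then
    commCoeff t μ (ε l) (ε k) (i (blockOf hV l)) (i (blockOf hV k)) else 1
  let a (r : V × V) : ℝ :=
    T r.1.1.1 r.2.1.1 * T r.1.1.1 r.2.1.2 * (T r.1.1.2 r.2.1.1 * T r.1.1.2 r.2.1.2)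
  have h1 : wordWeight (commCoeff t μ) (fun k => i (blockOf hV k)) ε = ∏ r, a r := by
    change ∏ k, ∏ l, T k l = _
    rw [prod_eq_prod_blocks hV fun k => ∏ l, T k l, Fintype.prod_prod_type]
    refine Finset.prod_congr rfl fun p _ => ?_
    rw [prod_eq_prod_blocks hV, prod_eq_prod_blocks hV, ← Finset.prod_mul_distrib]
  rw [h1, prod_block_pairs hV a]
  · refine Finset.prod_congr rfl ?_
    rintro ⟨p, p'⟩ hr
    have hww : p.1.1 < p'.1.1 := (Finset.mem_filter.1 hr).2
    have hne : i p ≠ i p' := hi.ne fun e => hww.ne (by rw [e])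
    have hwz' := fst_lt_snd_of_mem hV p'.2
    have hwz2 : p.1.1 < p'.1.2 := hww.trans hwz'
    have hzz : p.1.2 ≠ p'.1.2 := fun e => hww.ne (by rw [block_eq_of_snd_eq hV e])
    have hwz3 : p'.1.1 ≠ p.1.2 := fst_ne_snd_of_mem hV p' p
    obtain ⟨e1, e2⟩ := hε p.1 p.2
    obtain ⟨e1', e2'⟩ := hε p'.1 p'.2
    simp only [a, T, blockOf_fst, blockOf_snd, e1, e2, e1', e2', Prod.fst_swap, Prod.snd_swap,
      blockPairFactor, Crosses, Nests, hww, hww.not_gt, hwz', hwz2, hwz2.not_gt, true_and,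
      false_and, if_false]
    rcases lt_or_gt_of_ne hne with h | h
    · have h2 := (hz _ _ h).1
      have h3 := hμ _ _ h
      rcases lt_or_gt_of_ne hwz3 with h4 | h4
      · rcases lt_or_gt_of_ne hzz with h5 | h5
        · simp [h, h.not_gt, h2, h4, h4.not_gt, h5, h5.not_gt, commCoeff, upperCoeff]
        · simp [h, h.not_gt, h2, h4, h4.not_gt, h5, h5.not_gt, commCoeff, upperCoeff]
          ring
      · have h5 : p.1.2 < p'.1.2 := h4.trans hwz'
        simp [h.not_gt, h4.not_gt, h5.not_gt]
    · have h2 := (hz _ _ h).2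
      have h3 := hμ _ _ h
      rcases lt_or_gt_of_ne hwz3 with h4 | h4
      · rcases lt_or_gt_of_ne hzz with h5 | h5
        · simp [h, h.not_gt, h2, h4, h4.not_gt, h5, commCoeff, upperCoeff]
          field_simp
          simp
        · simp [h, h.not_gt, h4, h4.not_gt, h5, h5.not_gt, commCoeff, upperCoeff]
          field_simp
      · have h5 : p.1.2 < p'.1.2 := h4.trans hwz'
        simp [h, h.not_gt, h4, h4.not_gt, h5, h5.not_gt, commCoeff, upperCoeff]
        field_simp
  · intro p
    simp [a, T, blockOf_fst, blockOf_snd]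

variable {A : Type*} [Ring A] [StarRing A] [Algebra ℂ A] {φ : A →ₗ[ℂ] ℂ} {b : ℕ → A}
  {c : Expo → Expo → ℕ → ℕ → ℝ}

theorem map_word_pairing (h1 : φ 1 = 1) (hb : MomentCondition φ b) (hc : CommutationRelation c b)
    (hV : V ∈ pairPartitions m) {i : V → ℕ} (hi : Function.Injective i) (ε : Fin m → Expo) :
    φ (List.ofFn fun k => epow (b (i (blockOf hV k))) (ε k)).prod =
      wordWeight c (fun k => i (blockOf hV k)) ε *
        ∏ p ∈ V, φ (epow (b 0) (ε p.1) * epow (b 0) (ε p.2)) := by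
  classical
  have hN : ∀ p, i p < Finset.univ.sup i + 1 := fun p =>
    Nat.lt_succ_of_le (Finset.le_sup (Finset.mem_univ p))
  rw [map_word h1 hb.factors hc (fun k => i (blockOf hV k)) ε fun k => hN _]
  congr 1
  rw [← Finset.prod_subset (s₁ := Finset.univ.image i), Finset.prod_image fun p _ p' _ h => hi h,
    ← Finset.prod_coe_sort V]
  · refine Finset.prod_congr rfl fun p _ => ?_
    rw [subword_eq_filter, finRange_filter_eq_pair (fst_lt_snd_of_mem hV p.2) _ fun k => by
      rw [hi.eq_iff, blockOf_eq_iff]]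
    simpa using hb.cov_eq (i p) 0 (ε p.1.1) (ε p.1.2)
  · intro v hv
    obtain ⟨p, -, rfl⟩ := Finset.mem_image.1 hv
    exact Finset.mem_range.2 (hN p)
  · intro v _ hv
    have : ∀ k, i (blockOf hV k) ≠ v := fun k e =>
      hv (Finset.mem_image.2 ⟨_, Finset.mem_univ _, e⟩)
    simp [subword, this, h1]

/-- Among the four covariances only `φ(b b*)` may be nonzero; this is why the weights are computed
for a single pattern of exponents. -/
theorem prod_cov_eq_zero_or (hb : MomentCondition φ b) (V : Finset (Fin m × Fin m))
    (ε : Fin m → Expo) :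
    (∏ p ∈ V, φ (epow (b 0) (ε p.1) * epow (b 0) (ε p.2))) = 0 ∨
      ∀ p ∈ V, ε p.1 = Expo.one ∧ ε p.2 = Expo.adj := by
  refine or_iff_not_imp_left.2 fun h p hp => ?_
  have h' := Finset.prod_ne_zero_iff.1 h p hp
  rcases e : ε p.1 with _ | _ <;> rcases e' : ε p.2 with _ | _ <;> rw [e, e'] at h'
  · exact absurd (hb.mul_self 0) h'
  · exact ⟨rfl, rfl⟩
  · exact absurd (hb.star_mul_self 0) h'
  · exact absurd (hb.star_mul_star 0) h'

omit [StarRing A] in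
theorem prod_ofFn_smul (a : ℂ) {m : ℕ} (T : Fin m → A) :
    (List.ofFn fun k => a • T k).prod = a ^ m • (List.ofFn T).prod := by
  induction m with
  | zero => simp
  | succ m ih =>
    rw [List.ofFn_succ, List.prod_cons, ih, List.ofFn_succ, List.prod_cons, smul_mul_smul_comm,
      pow_succ']

theorem prod_ofFn_sum {R α : Type*} [Semiring R] [Fintype α] {m : ℕ} (F : Fin m → α → R) :
    (List.ofFn fun k => ∑ x, F k x).prod = ∑ j : Fin m → α, (List.ofFn fun k => F k (j k)).prod := by
  induction m with
  | zero => simp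
  | succ m ih =>
    rw [List.ofFn_succ, List.prod_cons, ih, Finset.sum_mul_sum, ← Fintype.sum_prod_type']
    refine Fintype.sum_equiv (Fin.consEquiv fun _ => α) _ _ fun x => ?_
    simp [List.ofFn_succ, Fin.consEquiv]

variable [StarModule ℂ A]

theorem epow_partialSum (b : ℕ → A) (N : ℕ) (e : Expo) :
    epow (partialSum b N) e = ((1 / Real.sqrt N : ℝ) : ℂ) • ∑ i : Fin N, epow (b i) e := by
  cases e
  · simp only [epow, partialSum, Finset.sum_range]
  · simp only [epow, partialSum, Finset.sum_range, star_smul, star_sum]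
    congr 1
    exact Complex.conj_ofReal _

theorem starMoment_partialSum (φ : A →ₗ[ℂ] ℂ) (b : ℕ → A) (N : ℕ) (ε : Fin m → Expo) :
    starMoment φ (partialSum b N) ε = ((1 / Real.sqrt N : ℝ) : ℂ) ^ m *
      ∑ j : Fin m → Fin N, φ (List.ofFn fun k => epow (b (j k)) (ε k)).prod := by
  unfold starMoment
  simp only [epow_partialSum]
  rw [prod_ofFn_smul, map_smul, smul_eq_mul, prod_ofFn_sum, map_sum]

omit [StarModule ℂ A] in
open Classical in
/-- The words that are not pairings do not contribute to the limit. -/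
theorem tendsto_sum_not_isPairing (h1 : φ 1 = 1) (hb : MomentCondition φ b)
    (hc : CommutationRelation c b) (ε : Fin m → Expo) :
    Tendsto (fun N : ℕ => ((1 / Real.sqrt N : ℝ) : ℂ) ^ m *
      ∑ j ∈ Finset.univ.filter (fun j : Fin m → Fin N => ¬ IsPairing j),
        φ (List.ofFn fun k => epow (b (j k)) (ε k)).prod) atTop (𝓝 0) := by
  rcases Nat.eq_zero_or_pos m with rfl | hm
  · refine tendsto_const_nhds.congr fun N => ?_
    rw [Finset.filter_false_of_mem, Finset.sum_empty, mul_zero]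
    exact fun j _ => not_not.2 fun k => k.elim0
  obtain ⟨α, hα⟩ := hb.bounded m
  -- Here `r` is the largest integer with `2 * r < m`, so `r` bounds the number of distinct indices
  -- in a contributing word that is not a pairing. The excess `d + 1 > 0` leaves a factor `(1 / √N)
  -- ^ (d + 1)`.
  obtain ⟨r, d, hr, hmr⟩ : ∃ r d, m = 2 * r + (d + 1) ∧ ∀ x, 2 * x < m → x ≤ r :=
    ⟨(m - 1) / 2, m - 2 * ((m - 1) / 2) - 1, by omega, fun x hx => by omega⟩
  have hα0 : 0 ≤ α := (norm_nonneg _).trans (hα (fun _ => 0) ε)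
  have hbound : ∀ N : ℕ, ‖∑ j ∈ Finset.univ.filter (fun j : Fin m → Fin N => ¬ IsPairing j),
      φ (List.ofFn fun k => epow (b (j k)) (ε k)).prod‖ ≤ r ^ m * N ^ r * α := by
    intro N
    have hsub : ∀ j ∈ Finset.univ.filter (fun j : Fin m → Fin N => ¬ IsPairing j),
        φ (List.ofFn fun k => epow (b (j k)) (ε k)).prod ≠ 0 →
          (Finset.univ.image j).card ≤ r := by
      intro j hj hne
      refine hmr _ (not_le.1 fun hle => (Finset.mem_filter.1 hj).2 ?_)
      refine isPairing_of_card_image (fun k₀ => ?_) hle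
      by_contra! hcon
      exact hne (map_word_eq_zero_of_unique_index h1 hb hc (fun k => (j k : ℕ)) ε
        (fun k => (j k).2) (k₀ := k₀) fun k hk => hcon k (Fin.val_injective hk))
    rw [← Finset.sum_filter_of_ne hsub]
    refine (norm_sum_le_of_le _ fun j _ => hα (fun k => j k) ε).trans ?_
    rw [Finset.sum_const, nsmul_eq_mul]
    refine mul_le_mul_of_nonneg_right ?_ hα0
    have := (Finset.card_le_card (Finset.filter_subset_filter _
      (Finset.filter_subset (fun j : Fin m → Fin N => ¬ IsPairing j) Finset.univ))).trans
        (card_filter_card_image_le m N r hm.ne')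
    exact_mod_cast this
  have hlim : Tendsto (fun N : ℕ => (r : ℝ) ^ m * α * (1 / Real.sqrt N) ^ (d + 1)) atTop (𝓝 0) := by
    have h2 : Tendsto (fun N : ℕ => 1 / Real.sqrt N) atTop (𝓝 0) := by
      simp only [one_div]
      exact tendsto_inv_atTop_zero.comp
        (Real.tendsto_sqrt_atTop.comp tendsto_natCast_atTop_atTop)
    simpa using (h2.pow (d + 1)).const_mul ((r : ℝ) ^ m * α)
  refine squeeze_zero_norm' ?_ hlim
  filter_upwards [eventually_gt_atTop 0] with N hN
  have hs : (1 / Real.sqrt N) ^ 2 * N = 1 := by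
    have hN' : (0 : ℝ) < N := by exact_mod_cast hN
    rw [div_pow, Real.sq_sqrt hN'.le]
    field_simp
  rw [norm_mul, norm_pow, Complex.norm_real, Real.norm_of_nonneg (by positivity)]
  calc (1 / Real.sqrt N) ^ m * ‖_‖ ≤ (1 / Real.sqrt N) ^ m * (r ^ m * N ^ r * α) :=
        mul_le_mul_of_nonneg_left (hbound N) (by positivity)
    _ = r ^ m * α * (1 / Real.sqrt N) ^ (d + 1) * ((1 / Real.sqrt N) ^ 2 * N) ^ r := by
        have : (1 / Real.sqrt N) ^ m = (1 / Real.sqrt N) ^ (2 * r + (d + 1)) := by rw [← hr]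
        rw [this]
        ring
    _ = r ^ m * α * (1 / Real.sqrt N) ^ (d + 1) := by rw [hs, one_pow, mul_one]

/-- The limit of the mixed moments of the normalized sums, given the limits of the averages of the
weights of all pairings. -/
theorem tendsto_starMoment_partialSum (h1 : φ 1 = 1) (hb : MomentCondition φ b) {q t : ℝ}
    (ht : t ≠ 0) {μ z : ℕ → ℕ → ℝ} (hμ : ∀ a b, a < b → μ a b ≠ 0)
    (hz : ∀ a b, a < b → z a b = μ a b ∧ z b a = μ a b)
    (hc : CommutationRelation (commCoeff t μ) b)
    (hlim : ∀ V ∈ pairPartitions m, Tendsto (fun N : ℕ =>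
      (∑ i : V ↪ Fin N, ∏ r ∈ orderedBlockPairs V,
        blockPairFactor t r (decide ((i r.1 : ℕ) < i r.2)) (z (i r.1) (i r.2))) /
          (N : ℝ) ^ Fintype.card V) atTop (𝓝 (q ^ crossings V * t ^ nestings V)))
    (ε : Fin m → Expo) :
    Tendsto (fun N => starMoment φ (partialSum b N) ε) atTop
      (𝓝 (∑ V ∈ pairPartitions m, (q : ℂ) ^ crossings V * (t : ℂ) ^ nestings V *
        ∏ p ∈ V, φ (epow (b 0) (ε p.1) * epow (b 0) (ε p.2)))) := by
  classical
  have hpair : Tendsto (fun N : ℕ => ∑ V : {V // V ∈ pairPartitions m},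
      ((1 / Real.sqrt N : ℝ) : ℂ) ^ m * ∑ i : V.1 ↪ Fin N,
        φ (List.ofFn fun k => epow (b (i (blockOf V.2 k))) (ε k)).prod) atTop
      (𝓝 (∑ V : {V // V ∈ pairPartitions m}, (q : ℂ) ^ crossings V.1 * (t : ℂ) ^ nestings V.1 *
        ∏ p ∈ V.1, φ (epow (b 0) (ε p.1) * epow (b 0) (ε p.2)))) := by
    refine tendsto_finsetSum _ fun V _ => ?_
    have hval : ∀ {N : ℕ} (i : V.1 ↪ Fin N), Function.Injective fun p => (i p : ℕ) := fun i =>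
      Fin.val_injective.comp i.injective
    have hword : ∀ (N : ℕ) (i : V.1 ↪ Fin N), _ := fun N i =>
      map_word_pairing h1 hb hc V.2 (hval i) ε
    simp only [hword]
    -- If the covariance product vanishes, both sides are zero whatever the weights do. Otherwise
    -- the exponents have the pattern for which the weights are known.
    rcases prod_cov_eq_zero_or hb V.1 ε with h0 | hε
    · simp [h0]
    · have h2 : Tendsto _ atTop _ := (Complex.continuous_ofReal.tendsto _).comp (hlim V.1 V.2)
      have h3 := h2.mul_const (∏ p ∈ V.1, φ (epow (b 0) (ε p.1) * epow (b 0) (ε p.2)))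
      simp only [Complex.ofReal_mul, Complex.ofReal_pow] at h3
      refine h3.congr fun N => ?_
      rw [← Finset.sum_mul, ← mul_assoc]
      congr 1
      simp only [Function.comp_apply]
      rw [← Complex.ofReal_pow, ← Complex.ofReal_sum, ← Complex.ofReal_mul]
      congr 1
      have hw : ∀ i : V.1 ↪ Fin N, _ := fun i => wordWeight_pairing V.2 (hval i) hε ht hμ hz
      simp only [hw]
      have hpow : (1 / Real.sqrt N) ^ m = (1 / Real.sqrt N) ^ (2 * V.1.card) := by
        rw [two_mul_card_of_mem_pairPartitions V.2]
      rw [hpow, pow_mul, div_pow, Real.sq_sqrt (Nat.cast_nonneg N), one_pow, one_div, inv_pow,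
        Fintype.card_coe, div_eq_inv_mul]
  have hsum := hpair.add (tendsto_sum_not_isPairing h1 hb hc ε)
  rw [add_zero, Finset.sum_coe_sort (pairPartitions m) fun V =>
    (q : ℂ) ^ crossings V * (t : ℂ) ^ nestings V *
      ∏ p ∈ V, φ (epow (b 0) (ε p.1) * epow (b 0) (ε p.2))] at hsum
  refine hsum.congr fun N => ?_
  rw [starMoment_partialSum, ← Finset.mul_sum, ← mul_add]
  congr 1
  rw [← Finset.sum_filter_add_sum_filter_not Finset.univ
    (fun j : Fin m → Fin N => IsPairing j)]
  congr 1
  exact (sum_isPairing fun j : Fin m → Fin N =>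
    φ (List.ofFn fun k => epow (b (j k)) (ε k)).prod).symm

end PairingMoments

end NCCLT

namespace NCCLT

/-! ### Almost sure averages of the pairing weights. -/

theorem measurable_blockPairFactor {m : ℕ} {V : Finset (Fin m × Fin m)} (t : ℝ) (r : V × V)
    (s : Bool) : Measurable (blockPairFactor t r s) := by
  unfold blockPairFactor
  split_ifs <;> fun_prop

/-- A common quadratic envelope for all factors, integrable under a second moment of `μ` alone. -/
theorem abs_blockPairFactor_le {m : ℕ} {V : Finset (Fin m × Fin m)} {t : ℝ} (ht : 0 < t)
    (r : V × V) (s : Bool) (y : ℝ) : |blockPairFactor t r s y| ≤ (1 + t) * (1 + y ^ 2) := by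
  have h1 : 0 ≤ t * y ^ 2 := by positivity
  have h2 : 0 ≤ y ^ 2 := sq_nonneg y
  unfold blockPairFactor
  split_ifs
  · have h3 : |y| ≤ 1 + y ^ 2 := by
      rw [← sq_abs]
      nlinarith [sq_nonneg (|y| - 1), abs_nonneg y]
    rw [abs_mul, abs_of_pos ht]
    nlinarith
  · rw [abs_of_nonneg h1]
    nlinarith
  · rw [abs_of_pos ht]
    nlinarith
  · rw [abs_one]
    nlinarith

/-- Almost surely, for every pair partition the weights of the injective labellings of its blocks
average to the product of `q` for each crossing and `t` for each nesting. -/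
theorem ae_tendsto_average_pairing_weights {Ω : Type*} [MeasurableSpace Ω] {P : Measure Ω}
    [IsProbabilityMeasure P] {X : IncPair → Ω → ℝ} {q t : ℝ} (ht : 0 < t)
    (hX : ∀ p, Measurable (X p)) (hind : iIndepFun X P)
    (hid : ∀ p p', IdentDistrib (X p) (X p') P P)
    (hint2 : ∀ p, Integrable (fun ω => X p ω ^ 2) P) (hmean : ∀ p, ∫ ω, X p ω ∂P = q / t)
    (hsq : ∀ p, ∫ ω, X p ω ^ 2 ∂P = 1) :
    ∀ᵐ ω ∂P, ∀ (m : ℕ) (V : Finset (Fin m × Fin m)), Tendsto (fun N : ℕ =>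
      (∑ i : V ↪ Fin N, ∏ r ∈ orderedBlockPairs V,
        blockPairFactor t r (decide ((i r.1 : ℕ) < i r.2))
          (symmExtend (fun p => X p ω) (i r.1) (i r.2))) / (N : ℝ) ^ Fintype.card V)
      atTop (𝓝 (q ^ crossings V * t ^ nestings V)) := by
  rw [ae_all_iff]
  intro m
  rw [ae_all_iff]
  intro V
  rw [← prod_orderedBlockPairs_eq]
  refine ae_tendsto_edge_product_average hX hind hid (R := orderedBlockPairs V)
    (g := blockPairFactor t) (fun r hr => ?_) (measurable_blockPairFactor t)
    (G := fun y => (1 + t) * (1 + y ^ 2)) (by fun_prop) (abs_blockPairFactor_le ht)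
    (fun p => ((integrable_const _).add (hint2 p)).const_mul _) (fun r _ s p => ?_)
  · have h := (Finset.mem_filter.1 hr).2
    refine ⟨fun e => h.ne (by rw [e]), fun h' => ?_⟩
    exact h.asymm (Finset.mem_filter.1 h').2
  -- The normalization `E μ² = 1` gives both nesting factors, `t * y ^ 2` and `t`, the mean `t`, so
  -- the mean does not depend on the order of the labels.
  · unfold blockPairFactor
    split_ifs
    · rw [integral_const_mul, hmean, mul_div_cancel₀ _ ht.ne']
    · rw [integral_const_mul, hsq, mul_one]
    · simp
    · simp

end NCCLT

/-! ### Conclusion on one event of full probability. -/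

theorem theorem1p4 {Ω : Type v} [MeasurableSpace Ω] (P : Measure Ω) [IsProbabilityMeasure P]
    (q t : ℝ) (ht : 0 < t)
    (μ : ℕ → ℕ → Ω → ℝ)
    (hmeas : ∀ i j, i < j → Measurable (μ i j))
    (hindep : iIndepFun (fun p : {p : ℕ × ℕ // p.1 < p.2} => μ p.1.1 p.1.2) P)
    (hident : ∀ i j k l, i < j → k < l → IdentDistrib (μ i j) (μ k l) P P)
    (hne : ∀ i j, i < j → ∀ᵐ ω ∂P, μ i j ω ≠ 0)
    (hint : ∀ i j, i < j → Integrable (μ i j) P)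
    (hint2 : ∀ i j, i < j → Integrable (fun ω => μ i j ω ^ 2) P)
    (hmean : ∀ i j, i < j → ∫ ω, μ i j ω ∂P = q / t)
    (hsq : ∀ i j, i < j → ∫ ω, μ i j ω ^ 2 ∂P = 1) :
    ∀ᵐ ω ∂P, ∀ (A : Type u) [Ring A] [StarRing A] [Algebra ℂ A] [StarModule ℂ A]
      (φ : A →ₗ[ℂ] ℂ) (b : ℕ → A),
      NCCLT.IsState φ →
      NCCLT.MomentCondition φ b →
      NCCLT.CommutationRelation (NCCLT.commCoeff t (fun i j => μ i j ω)) b →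
      (∀ (n : ℕ) (ε : Fin (2 * n + 1) → NCCLT.Expo),
        Tendsto (fun N => NCCLT.starMoment φ (NCCLT.partialSum b N) ε) atTop (𝓝 0)) ∧
      (∀ (n : ℕ) (ε : Fin (2 * n) → NCCLT.Expo),
        Tendsto (fun N => NCCLT.starMoment φ (NCCLT.partialSum b N) ε) atTop
          (𝓝 (∑ V ∈ NCCLT.pairPartitions (2 * n),
            (q : ℂ) ^ NCCLT.crossings V * (t : ℂ) ^ NCCLT.nestings V *
              ∏ p ∈ V, φ (NCCLT.epow (b 0) (ε p.1) * NCCLT.epow (b 0) (ε p.2))))) := by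
  have hlim := NCCLT.ae_tendsto_average_pairing_weights
    (X := fun p : NCCLT.IncPair => μ p.1.1 p.1.2) ht (fun p => hmeas _ _ p.2) hindep
    (fun p p' => hident _ _ _ _ p.2 p'.2) (fun p => hint2 _ _ p.2)
    (fun p => hmean _ _ p.2) fun p => hsq _ _ p.2
  have hne' : ∀ᵐ ω ∂P, ∀ i j, i < j → μ i j ω ≠ 0 := by
    simp only [ae_all_iff]
    exact hne
  filter_upwards [hlim, hne'] with ω hω hωne
  intro A _ _ _ _ φ b hφ hb hc
  have key : ∀ {m : ℕ} (ε : Fin m → NCCLT.Expo), _ := fun {m} ε =>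
    NCCLT.tendsto_starMoment_partialSum hφ.map_one hb ht.ne' hωne
      (z := NCCLT.symmExtend fun p => μ p.1.1 p.1.2 ω)
      (fun i j h => by simp [NCCLT.symmExtend, h, h.not_gt]) hc
      (fun V _ => hω m V) ε
  refine ⟨fun n ε => ?_, fun n ε => key ε⟩
  -- The same limit formula covers odd lengths, where the sum is empty.
  have hempty : NCCLT.pairPartitions (2 * n + 1) = ∅ := by
    refine Finset.eq_empty_of_forall_notMem fun V hV => ?_
    have := NCCLT.two_mul_card_of_mem_pairPartitions hV
    omega
  simpa only [hempty, Finset.sum_empty] using key ε
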